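/- Consider the problem EF Orientation with binary valuations. An instance is a finite undirected loopless multigraph $G=(V,E)$ (parallel edges allowed) with $n=|V|$ vertices (agents) and $m=|E|$ edges (goods), together with, for every edge $e$ with endpoints $i,j$, values $v_i(e),v_j(e)\in\{0,1\}$; set $v_u(e)=0$ for all $u\in V\setminus\{i,j\}$ and $v_u(X)=\sum_{e\in X}v_u(e)$ for $X\subseteq E$. An orientation assigns every edge to one of its two endpoints, which yields a partition of $E$ into (possibly empty) bundles $(X_u)_{u\in V}$; it is envy-free (EF) if $v_i(X_i)\ge v_i(X_j)$ for all $i,j\in V$. The question is whether $G$ admits an EF orientation. Theorem. There is an algorithm running in time $O(n+m)$ that decides EF Orientation with binary valuations on multigraphs. Precisely, there are a single RAM program (unit-cost assignment, addition, truncated subtraction, indirect addressing and comparison) and a constant $c$ such that on every instance, given as $n$, $m$ and the list of the edges with their endpoints and values, the program halts after at most $c\,(n+m+1)$ steps with the correct yes/no answer, all numbers in the computation being at most $c\,(n+m+1)$, i.e. fitting into words of $O(\log(n+m+1)+1)$ bits. -/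

import Mathlib

/-! ## Fair division on multigraphs -/

/-- A fair-division instance on a loopless undirected multigraph with vertices (agents)
`0, …, n - 1` and edges (goods) `0, …, m - 1`; parallel edges are allowed.
`val i e` is the value of the good `e` for the agent `i`. -/
structure EFInstance (n m : ℕ) where
  /-- the multigraph -/
  graph : Graph (Fin n) (Fin m)
  vertexSet_eq : graph.vertexSet = Set.univ
  edgeSet_eq : graph.edgeSet = Set.univ
  loopless : ∀ e i, ¬ graph.IsLoopAt e i
  /-- the value of a single good for an agent -/
  val : Fin n → Fin m → ℕ
  /-- a good is worth nothing to agents that are not endpoints of the edge -/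
  val_eq_zero : ∀ i e, ¬ graph.Inc e i → val i e = 0

namespace EFInstance

variable {n m : ℕ}

/-- All single goods have value `0` or `1`. -/
def IsBinary (I : EFInstance n m) : Prop :=
  ∀ i e, I.val i e = 0 ∨ I.val i e = 1

/-- The additive valuation of a bundle. -/
def value (I : EFInstance n m) (i : Fin n) (S : Finset (Fin m)) : ℕ :=
  ∑ e ∈ S, I.val i e

/-- The bundles `X 0, …, X (n - 1)` (possibly empty) form an allocation of all the goods:
each good lies in exactly one bundle. -/
def IsAllocation (_I : EFInstance n m) (X : Fin n → Finset (Fin m)) : Prop :=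
  ∀ e, ∃! i, e ∈ X i

/-- An orientation is an allocation giving each edge to one of its endpoints. -/
def IsOrientation (I : EFInstance n m) (X : Fin n → Finset (Fin m)) : Prop :=
  I.IsAllocation X ∧ ∀ i, ∀ e ∈ X i, I.graph.Inc e i

/-- Agent `i` envies agent `j`. -/
def Envies (I : EFInstance n m) (X : Fin n → Finset (Fin m)) (i j : Fin n) : Prop :=
  I.value i (X i) < I.value i (X j)

/-- No agent envies another agent. -/
def IsEnvyFree (I : EFInstance n m) (X : Fin n → Finset (Fin m)) : Prop :=
  ∀ i j, ¬ I.Envies X i j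

/-- The question of the problem EF Orientation. -/
def HasEFOrientation (I : EFInstance n m) : Prop :=
  ∃ X, I.IsOrientation X ∧ I.IsEnvyFree X

/-- `x e` and `y e` are the two endpoints of `e`, for every edge `e`
(listed in an arbitrary order). -/
def IsEndpointList (I : EFInstance n m) (x y : Fin m → Fin n) : Prop :=
  ∀ e, I.graph.IsLink e (x e) (y e)

/-- The input as a list of numbers: `n`, `m`, and then for each edge its two endpoints,
the value for the first endpoint and the value for the second endpoint. -/
def encode (I : EFInstance n m) (x y : Fin m → Fin n) : List ℕ :=
  n :: m :: (List.finRange m).flatMap fun e =>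
    [(x e : ℕ), (y e : ℕ), I.val (x e) e, I.val (y e) e]

end EFInstance

/-! ## Random access machines

A word RAM with registers and an indirectly addressed memory.  Programs are given in
structured form; every instruction and every evaluation of a test costs one time unit.
A machine of capacity `W` can only handle numbers `≤ W`, i.e. words of `O(log W)` bits. -/

namespace RAM

/-- Contents of the registers and of the memory. -/
structure State where
  reg : ℕ → ℕ
  mem : ℕ → ℕ

/-- Elementary instructions; the arguments are numbers of registers, except for the second
argument of `const`, which is the constant itself. -/
inductive Instr where
  /-- `R_d := k` -/
  | const (d k : ℕ)
  /-- `R_d := R_a` -/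
  | move (d a : ℕ)
  /-- `R_d := R_a + R_b` -/
  | add (d a b : ℕ)
  /-- `R_d := max (R_a - R_b) 0` -/
  | sub (d a b : ℕ)
  /-- `R_d := M[R_a]` -/
  | load (d a : ℕ)
  /-- `M[R_a] := R_b` -/
  | store (a b : ℕ)

/-- Set the register `d` to `v`. -/
def State.setReg (s : State) (d v : ℕ) : State :=
  { s with reg := Function.update s.reg d v }

/-- Set the memory cell with address `a` to `v`. -/
def State.setMem (s : State) (a v : ℕ) : State :=
  { s with mem := Function.update s.mem a v }

/-- Effect of an instruction on a machine of capacity `W`; `none` is a crash because the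
result does not fit into a word. -/
def Instr.exec (W : ℕ) (s : State) : Instr → Option State
  | .const d k => if k ≤ W then some (s.setReg d k) else none
  | .move d a => some (s.setReg d (s.reg a))
  | .add d a b => if s.reg a + s.reg b ≤ W then some (s.setReg d (s.reg a + s.reg b)) else none
  | .sub d a b => some (s.setReg d (s.reg a - s.reg b))
  | .load d a => some (s.setReg d (s.mem (s.reg a)))
  | .store a b => some (s.setMem (s.reg a) (s.reg b))

/-- Tests comparing two registers. -/
inductive Test where
  /-- `R_a < R_b` -/
  | lt (a b : ℕ)
  /-- `R_a = R_b` -/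
  | eq (a b : ℕ)

/-- The outcome of a test. -/
def Test.Holds (s : State) : Test → Prop
  | .lt a b => s.reg a < s.reg b
  | .eq a b => s.reg a = s.reg b

/-- Programs. -/
inductive Prog where
  | skip
  | instr (c : Instr)
  | seq (p q : Prog)
  | ite (b : Test) (p q : Prog)
  | loop (b : Test) (p : Prog)

/-- `Exec W p s t s'`: on a machine of capacity `W`, the program `p` started in the state `s`
halts after exactly `t` time units in the state `s'` (in particular it does not crash).
`loop b p` repeats `p` as long as the test `b` holds. -/
inductive Exec (W : ℕ) : Prog → State → ℕ → State → Prop where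
  | skip (s : State) : Exec W .skip s 1 s
  | instr {c : Instr} {s s' : State} (h : c.exec W s = some s') : Exec W (.instr c) s 1 s'
  | seq {p q : Prog} {s s' s'' : State} {t t' : ℕ}
      (hp : Exec W p s t s') (hq : Exec W q s' t' s'') : Exec W (.seq p q) s (t + t') s''
  | ite_true {b : Test} {p q : Prog} {s s' : State} {t : ℕ}
      (hb : b.Holds s) (hp : Exec W p s t s') : Exec W (.ite b p q) s (1 + t) s'
  | ite_false {b : Test} {p q : Prog} {s s' : State} {t : ℕ}
      (hb : ¬ b.Holds s) (hq : Exec W q s t s') : Exec W (.ite b p q) s (1 + t) s'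
  | loop_true {b : Test} {p : Prog} {s s' s'' : State} {t t' : ℕ}
      (hb : b.Holds s) (hp : Exec W p s t s') (hl : Exec W (.loop b p) s' t' s'') :
      Exec W (.loop b p) s (1 + t + t') s''
  | loop_false {b : Test} {p : Prog} {s : State}
      (hb : ¬ b.Holds s) : Exec W (.loop b p) s 1 s

/-- Programs are deterministic: running time and final state are unique. -/
theorem Exec.deterministic {W : ℕ} {p : Prog} {s s₁ s₂ : State} {t₁ t₂ : ℕ}
    (h₁ : Exec W p s t₁ s₁) (h₂ : Exec W p s t₂ s₂) : t₁ = t₂ ∧ s₁ = s₂ := by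
  induction h₁ generalizing t₂ s₂ with
  | skip s => cases h₂; exact ⟨rfl, rfl⟩
  | instr h =>
    cases h₂ with
    | instr h' => rw [h] at h'; exact ⟨rfl, Option.some.inj h'⟩
  | seq _ _ ihp ihq =>
    cases h₂ with
    | seq hp' hq' =>
      obtain ⟨rfl, rfl⟩ := ihp hp'
      obtain ⟨rfl, rfl⟩ := ihq hq'
      exact ⟨rfl, rfl⟩
  | ite_true hb _ ih =>
    cases h₂ with
    | ite_true _ h' => obtain ⟨rfl, rfl⟩ := ih h'; exact ⟨rfl, rfl⟩
    | ite_false hb' _ => exact absurd hb hb'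
  | ite_false hb _ ih =>
    cases h₂ with
    | ite_true hb' _ => exact absurd hb' hb
    | ite_false _ h' => obtain ⟨rfl, rfl⟩ := ih h'; exact ⟨rfl, rfl⟩
  | loop_true hb _ _ ihp ihl =>
    cases h₂ with
    | loop_true _ hp' hl' =>
      obtain ⟨rfl, rfl⟩ := ihp hp'
      obtain ⟨rfl, rfl⟩ := ihl hl'
      exact ⟨rfl, rfl⟩
    | loop_false hb' => exact absurd hb hb'
  | loop_false hb =>
    cases h₂ with
    | loop_true hb' _ _ => exact absurd hb' hb
    | loop_false _ => exact ⟨rfl, rfl⟩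

/-- The start of a computation: the input is in the memory cells `0, 1, 2, …`, all other
cells and all registers are `0`. -/
def initState (input : List ℕ) : State where
  reg := fun _ => 0
  mem := fun a => input.getD a 0

/-- On a machine of capacity `W`, the program `p` halts on `input` within `T` time units and
answers the question whether `Q` holds: register `0` finally contains `1` if `Q` is true and
`0` if `Q` is false. -/
def DecidesWithin (W : ℕ) (p : Prog) (input : List ℕ) (T : ℕ) (Q : Prop) : Prop :=
  ∃ t s, Exec W p (initState input) t s ∧ t ≤ T ∧
    ((Q ∧ s.reg 0 = 1) ∨ (¬ Q ∧ s.reg 0 = 0))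

end RAM

/-! ## A verification layer for RAM programs -/

namespace RAM

set_option linter.constructorNameAsVariable false

/-! Call a good exclusive to `i` if only `i` values it, and mutual for `i` and `j` if both do. An
agent can be given all its exclusive goods without causing envy, so only the division of the mutual
goods matters. Let `μ i j` be the number of goods mutual for `i` and `j`. If every `μ i j` is split
as evenly as possible, then `i` receives its exclusive goods, half of each `μ i j` rounded down, and
one extra good for each odd `μ i j` where it gets the larger part. Any single extra good removes all
envy of `i`. Without one, `i` is still content unless twice its guaranteed value is below some `μ i
j`; then `i` is `Needy`. In that case `μ i j` is odd, `i` has no exclusive goods and all other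
multiplicities at `i` are at most `1`, so even an uneven division cannot help: in every envy-free
orientation `i` gets the larger part at some odd neighbour. Hence an EF orientation exists iff the
needy vertices can choose distinct incident edges in the simple graph of odd multiplicities
(`hasEFOrientation_iff_solvable`).

This choice is found by peeling. A needy vertex with a single edge must take it, and the vertex is
then deleted (`solvable_iff_of_leaf`). If its neighbour is needy and had no other edge, the answer
is no. When every remaining needy vertex has degree at least `2`, Hall's theorem gives a choice,
because an edge has only two ends (`solvable_of_two_le_card`).

For linear time, the incidence lists are threaded through the input cells. One pass over the list of
a vertex finds the largest multiplicity, the odd degree, and the sum modulo `n` of the odd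
neighbours; a second pass clears the counters. Degree and sum suffice for peeling: at degree `1` the
sum is the remaining neighbour, so no adjacency list is needed. A deletion can create a new leaf
only at that neighbour, so one scan over the vertices that follows these paths finds all leaves, and
each deletion is paid for by the vertex deleted.

Correctness, running time and word size on the RAM are proved together, by weakest preconditions for
loop-free commands and a loop rule with a potential. -/

/-- Named registers. -/
inductive Reg where
  | ans | zero | one | two | n | fin | i | p | q | x | y | a | b | s | t
  | h | h₀ | j | c | k | d | u | w
  deriving DecidableEq

/-- The number of a named register. -/
def Reg.idx : Reg → ℕ
  | ans => 0 | zero => 1 | one => 2 | two => 3 | n => 4 | fin => 5 | i => 6 | p => 7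
  | q => 8 | x => 9 | y => 10 | a => 11 | b => 12 | s => 13 | t => 14 | h => 15 | h₀ => 16
  | j => 17 | c => 18 | k => 19 | d => 20 | u => 21 | w => 22

theorem Reg.idx_lt (r : Reg) : r.idx < 40 := by cases r <;> decide

theorem Reg.idx_inj {r r' : Reg} : r.idx = r'.idx ↔ r = r' := by
  constructor
  · cases r <;> cases r' <;> simp [Reg.idx]
  · rintro rfl; rfl

/-- Named arrays. -/
inductive Arr where
  | head | slack | cnt | par | deg | sum
  deriving DecidableEq

/-- The number of a named array. -/
def Arr.idx : Arr → ℕ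
  | head => 0 | slack => 1 | cnt => 2 | par => 3 | deg => 4 | sum => 5

theorem Arr.idx_lt (k : Arr) : k.idx < 6 := by cases k <;> decide

theorem Arr.idx_inj {k k' : Arr} : k.idx = k'.idx ↔ k = k' := by
  constructor
  · cases k <;> cases k' <;> simp [Arr.idx]
  · rintro rfl; rfl

/-- Machine states with named registers, an input area and named arrays. -/
structure AState where
  reg : Reg → ℕ
  inp : ℕ → ℕ
  arr : Arr → ℕ → ℕ

/-- Set a register. -/
def AState.setReg (σ : AState) (r : Reg) (v : ℕ) : AState :=
  { σ with reg := Function.update σ.reg r v }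

/-- Set a cell of the input area. -/
def AState.setInp (σ : AState) (l v : ℕ) : AState :=
  { σ with inp := Function.update σ.inp l v }

/-- Set an entry of an array. -/
def AState.setArr (σ : AState) (k : Arr) (l v : ℕ) : AState :=
  { σ with arr := Function.update σ.arr k (Function.update (σ.arr k) l v) }

section

variable (σ : AState) (r r' : Reg) (k k' : Arr) (l v : ℕ)

@[simp] theorem AState.reg_setReg :
    (σ.setReg r v).reg r' = if r' = r then v else σ.reg r' := Function.update_apply ..

@[simp] theorem AState.inp_setReg : (σ.setReg r v).inp = σ.inp := rfl

@[simp] theorem AState.arr_setReg : (σ.setReg r v).arr = σ.arr := rfl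

@[simp] theorem AState.reg_setInp : (σ.setInp l v).reg = σ.reg := rfl

@[simp] theorem AState.inp_setInp : (σ.setInp l v).inp = Function.update σ.inp l v := rfl

@[simp] theorem AState.arr_setInp : (σ.setInp l v).arr = σ.arr := rfl

@[simp] theorem AState.reg_setArr : (σ.setArr k l v).reg = σ.reg := rfl

@[simp] theorem AState.inp_setArr : (σ.setArr k l v).inp = σ.inp := rfl

@[simp] theorem AState.arr_setArr : (σ.setArr k l v).arr k' =
    if k' = k then Function.update (σ.arr k) l v else σ.arr k' := Function.update_apply ..

end

/-! ### Representation of named registers and arrays in the RAM. -/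

/-- The state `s` represents `σ`: the input area ends at `B`, where the interleaved arrays
start. -/
structure Rep (B : ℕ) (σ : AState) (s : State) : Prop where
  reg : ∀ r : Reg, s.reg r.idx = σ.reg r
  base : ∀ k : Arr, s.reg (40 + k.idx) = B + k.idx
  inp : ∀ l < B, s.mem l = σ.inp l
  arr : ∀ (k : Arr) (l : ℕ), s.mem (8 * l + (B + k.idx)) = σ.arr k l

theorem Rep.setReg {B : ℕ} {σ : AState} {s : State} (h : Rep B σ s) (r : Reg) (v : ℕ) :
    Rep B (σ.setReg r v) (s.setReg r.idx v) where
  reg r' := by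
    simp only [State.setReg, AState.setReg, Function.update_apply, Reg.idx_inj, h.reg]
  base k := by
    have := r.idx_lt
    simp only [State.setReg, Function.update_apply, h.base]
    rw [if_neg (by omega)]
  inp := h.inp
  arr := h.arr

theorem Rep.setTemp {B : ℕ} {σ : AState} {s : State} (h : Rep B σ s) (v : ℕ) :
    Rep B σ (s.setReg 48 v) where
  reg r := by
    have := r.idx_lt
    simp only [State.setReg, Function.update_apply, h.reg]
    rw [if_neg (by omega)]
  base k := by
    have := k.idx_lt
    simp only [State.setReg, Function.update_apply, h.base]
    rw [if_neg (by omega)]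
  inp := h.inp
  arr := h.arr

theorem Rep.setInp {B : ℕ} {σ : AState} {s : State} (h : Rep B σ s) {l : ℕ} (hl : l < B)
    (v : ℕ) : Rep B (σ.setInp l v) (s.setMem l v) where
  reg := h.reg
  base := h.base
  inp l' hl' := by
    simp only [State.setMem, AState.setInp, Function.update_apply, h.inp l' hl']
  arr k l' := by
    simp only [State.setMem, AState.setInp, Function.update_apply, h.arr]
    rw [if_neg (by omega)]

/-- The stride `8` exceeds every array number, so distinct pairs of array and index have distinct
addresses, all at least `B`. Interleaving makes the layout independent of the array lengths. -/
theorem Rep.setArr {B : ℕ} {σ : AState} {s : State} (h : Rep B σ s) (k : Arr) (l v : ℕ) :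
    Rep B (σ.setArr k l v) (s.setMem (8 * l + (B + k.idx)) v) where
  reg := h.reg
  base := h.base
  inp l' hl' := by
    simp only [State.setMem, AState.setArr, Function.update_apply, h.inp l' hl']
    rw [if_neg (by omega)]
  arr k' l' := by
    have := k.idx_lt
    have := k'.idx_lt
    simp only [State.setMem, AState.setArr, Function.update_apply, h.arr]
    by_cases hk : k' = k
    · subst hk
      simp [Function.update_apply]
    · have : k'.idx ≠ k.idx := fun h => hk (Arr.idx_inj.1 h)
      rw [if_neg (by omega), if_neg hk]

/-- Tests on named registers. -/
inductive Cond where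
  | lt (a b : Reg)
  | eq (a b : Reg)

/-- The test of the RAM. -/
def Cond.test : Cond → Test
  | .lt a b => .lt a.idx b.idx
  | .eq a b => .eq a.idx b.idx

/-- The outcome of a test. -/
def Cond.Holds (σ : AState) : Cond → Prop
  | .lt a b => σ.reg a < σ.reg b
  | .eq a b => σ.reg a = σ.reg b

theorem Rep.holds_iff {B : ℕ} {σ : AState} {s : State} (h : Rep B σ s) (b : Cond) :
    b.test.Holds s ↔ b.Holds σ := by
  cases b <;> simp [Cond.test, Cond.Holds, Test.Holds, h.reg]

/-! ### Loop-free commands and weakest preconditions. -/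

/-- Loop-free programs. -/
inductive Cmd where
  | skip
  | const (d : Reg) (k : ℕ)
  | move (d a : Reg)
  | add (d a b : Reg)
  | sub (d a b : Reg)
  | ldI (d a : Reg)
  | stI (a b : Reg)
  | ldA (d : Reg) (k : Arr) (l : Reg)
  | stA (k : Arr) (l a : Reg)
  | seq (p q : Cmd)
  | ite (b : Cond) (p q : Cmd)

/-- Sequential composition. -/
infixr:60 " ;; " => Cmd.seq

/-- Compute the address of an array entry in the temporary register. -/
def addr (k : Arr) (l : Reg) (p : Prog) : Prog :=
  .seq (.instr (.add 48 l.idx l.idx)) (.seq (.instr (.add 48 48 48))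
    (.seq (.instr (.add 48 48 48)) (.seq (.instr (.add 48 48 (40 + k.idx))) p)))

/-- Translation to the RAM. -/
def Cmd.prog : Cmd → Prog
  | .skip => .skip
  | .const d k => .instr (.const d.idx k)
  | .move d a => .instr (.move d.idx a.idx)
  | .add d a b => .instr (.add d.idx a.idx b.idx)
  | .sub d a b => .instr (.sub d.idx a.idx b.idx)
  | .ldI d a => .instr (.load d.idx a.idx)
  | .stI a b => .instr (.store a.idx b.idx)
  | .ldA d k l => addr k l (.instr (.load d.idx 48))
  | .stA k l a => addr k l (.instr (.store 48 a.idx))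
  | .seq p q => .seq p.prog q.prog
  | .ite b p q => .ite b.test p.prog q.prog

/-- An upper bound for the running time. -/
def Cmd.cost : Cmd → ℕ
  | .ldA _ _ _ => 5
  | .stA _ _ _ => 5
  | .seq p q => p.cost + q.cost
  | .ite _ p q => 1 + (p.cost + q.cost)
  | _ => 1

/-- Weakest preconditions on a machine of capacity `W` with the arrays starting at `B`. -/
def Cmd.wp (W B : ℕ) : Cmd → (AState → Prop) → AState → Prop
  | .skip, Q, σ => Q σ
  | .const d k, Q, σ => k ≤ W ∧ Q (σ.setReg d k)
  | .move d a, Q, σ => Q (σ.setReg d (σ.reg a))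
  | .add d a b, Q, σ => σ.reg a + σ.reg b ≤ W ∧ Q (σ.setReg d (σ.reg a + σ.reg b))
  | .sub d a b, Q, σ => Q (σ.setReg d (σ.reg a - σ.reg b))
  | .ldI d a, Q, σ => σ.reg a < B ∧ Q (σ.setReg d (σ.inp (σ.reg a)))
  | .stI a b, Q, σ => σ.reg a < B ∧ Q (σ.setInp (σ.reg a) (σ.reg b))
  | .ldA d k l, Q, σ => 8 * σ.reg l + B + 8 ≤ W ∧ Q (σ.setReg d (σ.arr k (σ.reg l)))
  | .stA k l a, Q, σ => 8 * σ.reg l + B + 8 ≤ W ∧ Q (σ.setArr k (σ.reg l) (σ.reg a))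
  | .seq p q, Q, σ => p.wp W B (q.wp W B Q) σ
  | .ite b p q, Q, σ => (b.Holds σ → p.wp W B Q σ) ∧ (¬ b.Holds σ → q.wp W B Q σ)

/-! ### Timed total-correctness rules. -/

/-- Started in a representation of `σ`, the program `p` halts after some time `t` in a
representation of some `σ'` with `Q t σ'`. -/
def Runs (W B : ℕ) (p : Prog) (σ : AState) (Q : ℕ → AState → Prop) : Prop :=
  ∀ s, Rep B σ s → ∃ t s' σ', Exec W p s t s' ∧ Rep B σ' s' ∧ Q t σ'

section

variable {W B : ℕ}

theorem Runs.mono {p : Prog} {σ : AState} {Q Q' : ℕ → AState → Prop} (h : Runs W B p σ Q)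
    (hQ : ∀ t σ', Q t σ' → Q' t σ') : Runs W B p σ Q' := by
  intro s hs
  obtain ⟨t, s', σ', he, hr, hq⟩ := h s hs
  exact ⟨t, s', σ', he, hr, hQ _ _ hq⟩

theorem Runs.seq {p q : Prog} {σ : AState} {Q R : ℕ → AState → Prop} (hp : Runs W B p σ Q)
    (hq : ∀ t σ', Q t σ' → Runs W B q σ' fun t' σ'' => R (t + t') σ'') :
    Runs W B (.seq p q) σ R := by
  intro s hs
  obtain ⟨t, s', σ', he, hr, h⟩ := hp s hs
  obtain ⟨t', s'', σ'', he', hr', h'⟩ := hq t σ' h s' hr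
  exact ⟨_, s'', σ'', .seq he he', hr', h'⟩

theorem Runs.ite {b : Cond} {p q : Prog} {σ : AState} {Q : ℕ → AState → Prop}
    (hp : b.Holds σ → Runs W B p σ fun t σ' => Q (1 + t) σ')
    (hq : ¬ b.Holds σ → Runs W B q σ fun t σ' => Q (1 + t) σ') :
    Runs W B (.ite b.test p q) σ Q := by
  intro s hs
  by_cases hb : b.Holds σ
  · obtain ⟨t, s', σ', he, hr, h⟩ := hp hb s hs
    exact ⟨_, s', σ', .ite_true ((hs.holds_iff b).2 hb) he, hr, h⟩
  · obtain ⟨t, s', σ', he, hr, h⟩ := hq hb s hs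
    exact ⟨_, s', σ', .ite_false (fun h => hb ((hs.holds_iff b).1 h)) he, hr, h⟩

/-- The loop rule; the potential `k` pays for the remaining iterations. -/
theorem Runs.loop {b : Cond} {p : Prog} (Inv : ℕ → AState → Prop)
    (hp : ∀ k σ, Inv k σ → b.Holds σ →
      Runs W B p σ fun t σ' => ∃ k', Inv k' σ' ∧ 1 + t + k' ≤ k)
    {k : ℕ} {σ : AState} (h : Inv k σ) :
    Runs W B (.loop b.test p) σ
      fun t σ' => ∃ k', Inv k' σ' ∧ ¬ b.Holds σ' ∧ t + k' ≤ k + 1 := by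
  induction k using Nat.strong_induction_on generalizing σ with
  | _ k ih =>
    intro s hs
    by_cases hb : b.Holds σ
    · obtain ⟨t, s', σ', he, hr, k', hi, hk⟩ := hp k σ h hb s hs
      obtain ⟨t', s'', σ'', he', hr', k'', hi', hb', hk'⟩ := ih k' (by omega) hi s' hr
      exact ⟨_, s'', σ'', .loop_true ((hs.holds_iff b).2 hb) he he', hr', k'', hi', hb',
        by omega⟩
    · exact ⟨1, s, σ, .loop_false (fun h => hb ((hs.holds_iff b).1 h)), hs, k, h, hb,
        by omega⟩

/-- Three doublings produce `8 * l` and a fourth addition adds the base of the array, which accounts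
for the `4` extra steps. All intermediate values lie below the final bound, so the capacity is
respected. -/
theorem exec_addr {k : Arr} {l : Reg} {σ : AState} {s s' : State} {p : Prog} {t : ℕ}
    (hs : Rep B σ s) (hW : 8 * σ.reg l + B + 8 ≤ W)
    (hp : Exec W p (s.setReg 48 (8 * σ.reg l + (B + k.idx))) t s') :
    Exec W (addr k l p) s (t + 4) s' := by
  have hk := k.idx_lt
  have h40 : (40 + k.idx = 48) = False := by simp; omega
  have hset : ∀ v v' : ℕ, (s.setReg 48 v).setReg 48 v' = s.setReg 48 v' := by
    intro v v'; simp [State.setReg]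
  have h48 : ∀ v : ℕ, (s.setReg 48 v).reg 48 = v := by intro v; simp [State.setReg]
  have hb : ∀ v : ℕ, (s.setReg 48 v).reg (40 + k.idx) = B + k.idx := by
    intro v; simp [State.setReg, hs.base, h40]
  have e : t + 4 = 1 + (1 + (1 + (1 + t))) := by omega
  rw [e]
  refine .seq (s' := s.setReg 48 (σ.reg l + σ.reg l)) (.instr ?_)
    (.seq (s' := s.setReg 48 (4 * σ.reg l)) (.instr ?_)
    (.seq (s' := s.setReg 48 (8 * σ.reg l)) (.instr ?_)
    (.seq (s' := s.setReg 48 (8 * σ.reg l + (B + k.idx))) (.instr ?_) hp)))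
  · simp only [Instr.exec, hs.reg]
    rw [if_pos (by omega)]
  · simp only [Instr.exec, h48, hset]
    rw [if_pos (by omega)]
    congr 2; omega
  · simp only [Instr.exec, h48, hset]
    rw [if_pos (by omega)]
    congr 2; omega
  · simp only [Instr.exec, h48, hset, hb]
    rw [if_pos (by omega)]

/-- Soundness of `Cmd.wp`: it reduces every loop-free piece of the algorithm to a symbolic
evaluation on named registers and arrays. -/
theorem Cmd.runs (c : Cmd) {Q : AState → Prop} {σ : AState} (h : c.wp W B Q σ) :
    Runs W B c.prog σ fun t σ' => t ≤ c.cost ∧ Q σ' := by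
  induction c generalizing Q σ with
  | skip => exact fun s hs => ⟨1, s, σ, .skip s, hs, le_rfl, h⟩
  | const d k =>
    exact fun s hs => ⟨1, _, _, .instr (if_pos h.1), hs.setReg d k, le_rfl, h.2⟩
  | move d a =>
    exact fun s hs => ⟨1, _, _, .instr rfl, hs.reg a ▸ hs.setReg d _, le_rfl, h⟩
  | add d a b =>
    intro s hs
    refine ⟨1, _, _, .instr (s' := s.setReg d.idx (σ.reg a + σ.reg b)) ?_, hs.setReg d _,
      le_rfl, h.2⟩
    simp only [Instr.exec, hs.reg]
    exact if_pos h.1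
  | sub d a b =>
    intro s hs
    refine ⟨1, _, _, .instr (s' := s.setReg d.idx (σ.reg a - σ.reg b)) ?_, hs.setReg d _,
      le_rfl, h⟩
    simp only [Instr.exec, hs.reg]
  | ldI d a =>
    intro s hs
    refine ⟨1, _, _, .instr (s' := s.setReg d.idx (σ.inp (σ.reg a))) ?_, hs.setReg d _,
      le_rfl, h.2⟩
    simp only [Instr.exec, hs.reg, hs.inp _ h.1]
  | stI a b =>
    intro s hs
    refine ⟨1, _, _, .instr (s' := s.setMem (σ.reg a) (σ.reg b)) ?_, hs.setInp h.1 _,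
      le_rfl, h.2⟩
    simp only [Instr.exec, hs.reg]
  | ldA d k l =>
    intro s hs
    refine ⟨1 + 4, _, _, exec_addr hs h.1
      (.instr (s' := (s.setReg 48 (8 * σ.reg l + (B + k.idx))).setReg d.idx
        (σ.arr k (σ.reg l))) ?_), (hs.setTemp _).setReg d _, le_rfl, h.2⟩
    simp [Instr.exec, State.setReg, hs.arr]
  | stA k l a =>
    intro s hs
    refine ⟨1 + 4, _, _, exec_addr hs h.1
      (.instr (s' := (s.setReg 48 (8 * σ.reg l + (B + k.idx))).setMem
        (8 * σ.reg l + (B + k.idx)) (σ.reg a)) ?_), (hs.setTemp _).setArr k _ _, le_rfl, h.2⟩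
    simp only [Instr.exec, (hs.setTemp _).reg]
    simp [State.setReg]
  | seq p q ihp ihq =>
    refine (ihp h).seq fun t σ' h' => (ihq h'.2).mono fun t' σ'' h'' => ⟨?_, h''.2⟩
    have := h'.1
    have := h''.1
    simp only [Cmd.cost]
    omega
  | ite b p q ihp ihq =>
    refine Runs.ite (fun hb => (ihp (h.1 hb)).mono fun t σ' h' => ⟨?_, h'.2⟩)
      (fun hb => (ihq (h.2 hb)).mono fun t σ' h' => ⟨?_, h'.2⟩)
    all_goals
      have := h'.1
      simp only [Cmd.cost]
      omega

end

end RAM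

/-! ### Reduction of EF orientations to a choice of edges in the odd-multiplicity graph. -/

/-- Every `u` with `U u` can be assigned one of the edges from `u` to `N u`, with no edge
assigned to both of its endpoints. -/
def Solvable {α : Type*} (N : α → Finset α) (U : α → Prop) : Prop :=
  ∃ f : α → α, ∀ u, U u → f u ∈ N u ∧ (U (f u) → f (f u) ≠ u)

namespace EFInstance

variable {n m : ℕ} (I : EFInstance n m)

/-- The good `e` has value `1` for `i` only. -/
def Excl (i : Fin n) (e : Fin m) : Prop := I.val i e = 1 ∧ ∀ j, j ≠ i → I.val j e = 0

/-- The good `e` has value `1` for both `i` and `j`. -/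
def Mutual (i j : Fin n) (e : Fin m) : Prop := i ≠ j ∧ I.val i e = 1 ∧ I.val j e = 1

instance (i : Fin n) : DecidablePred (I.Excl i) :=
  fun e => inferInstanceAs (Decidable (I.val i e = 1 ∧ ∀ j, j ≠ i → I.val j e = 0))

instance (i j : Fin n) : DecidablePred (I.Mutual i j) :=
  fun e => inferInstanceAs (Decidable (i ≠ j ∧ I.val i e = 1 ∧ I.val j e = 1))

/-- The number of goods with value `1` for both `i` and `j`. -/
def mult (i j : Fin n) : ℕ := (Finset.univ.filter (I.Mutual i j)).card

/-- The number of goods with value `1` for `i` only. -/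
def excl (i : Fin n) : ℕ := (Finset.univ.filter (I.Excl i)).card

/-- The vertices that share an odd number of goods with `i`. -/
def oddNbrs (i : Fin n) : Finset (Fin n) := Finset.univ.filter fun j => Odd (I.mult i j)

/-- The vertex `i` envies a neighbour unless it gets the larger part of the goods shared with
one of its `oddNbrs`. -/
def Needy (i : Fin n) : Prop :=
  (I.oddNbrs i).Nonempty ∧
    ∃ j, 2 * I.excl i + ∑ l, I.mult i l < I.mult i j + (I.oddNbrs i).card

/-- The bundle of `i` if `o e` is the owner of `e`. -/
def bundle (o : Fin m → Fin n) (i : Fin n) : Finset (Fin m) :=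
  Finset.univ.filter fun e => o e = i

/-- The number of goods shared by `i` and `j` that `i` owns. -/
def share (o : Fin m → Fin n) (i j : Fin n) : ℕ := ((bundle o i).filter (I.Mutual i j)).card

variable {I}

theorem Mutual.symm {i j : Fin n} {e : Fin m} (h : I.Mutual i j e) : I.Mutual j i e :=
  ⟨h.1.symm, h.2.2, h.2.1⟩

theorem mutual_comm {i j : Fin n} : I.Mutual i j = I.Mutual j i :=
  funext fun _ => propext ⟨Mutual.symm, Mutual.symm⟩

theorem mult_comm (i j : Fin n) : I.mult i j = I.mult j i := by
  unfold mult
  congr 1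
  ext e
  simp only [Finset.mem_filter]
  rw [mutual_comm]

theorem mult_self (i : Fin n) : I.mult i i = 0 := by simp [mult, Mutual]

theorem share_self (o : Fin m → Fin n) (i : Fin n) : I.share o i i = 0 := by
  rw [share, Finset.card_eq_zero, Finset.filter_eq_empty_iff]
  exact fun _ _ h => h.1 rfl

variable {x y : Fin m → Fin n}

theorem IsEndpointList.inc_iff (h : I.IsEndpointList x y) {e : Fin m} {i : Fin n} :
    I.graph.Inc e i ↔ i = x e ∨ i = y e := by
  constructor
  · intro hi
    exact hi.eq_or_eq_of_isLink (h e)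
  · rintro (rfl | rfl)
    · exact (h e).inc_left
    · exact (h e).inc_right

theorem IsEndpointList.ne (h : I.IsEndpointList x y) (e : Fin m) : x e ≠ y e := by
  intro hxy
  have := h e
  rw [← hxy] at this
  exact I.loopless e (x e) this

theorem IsEndpointList.of_val (h : I.IsEndpointList x y) {e : Fin m} {i : Fin n}
    (hi : I.val i e = 1) : i = x e ∨ i = y e := by
  rw [← h.inc_iff]
  by_contra hn
  rw [I.val_eq_zero i e hn] at hi
  exact zero_ne_one hi

theorem IsEndpointList.mutual_iff (h : I.IsEndpointList x y) {e : Fin m} {i j : Fin n} :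
    I.Mutual i j e ↔ (I.val (x e) e = 1 ∧ I.val (y e) e = 1) ∧
      ((x e = i ∧ y e = j) ∨ (x e = j ∧ y e = i)) := by
  have hne := h.ne e
  constructor
  · rintro ⟨hij, hi, hj⟩
    rcases h.of_val hi with rfl | rfl <;> rcases h.of_val hj with rfl | rfl <;> tauto
  · rintro ⟨hv, ⟨rfl, rfl⟩ | ⟨rfl, rfl⟩⟩
    · exact ⟨hne, hv⟩
    · exact ⟨hne.symm, hv.symm⟩

theorem IsEndpointList.excl_iff (h : I.IsEndpointList x y) (hI : I.IsBinary) {e : Fin m}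
    {i : Fin n} : I.Excl i e ↔ (x e = i ∧ I.val (x e) e = 1 ∧ I.val (y e) e = 0) ∨
      (y e = i ∧ I.val (y e) e = 1 ∧ I.val (x e) e = 0) := by
  have hne := h.ne e
  constructor
  · rintro ⟨hi, hj⟩
    rcases h.of_val hi with rfl | rfl
    · exact .inl ⟨rfl, hi, hj _ hne.symm⟩
    · exact .inr ⟨rfl, hi, hj _ hne⟩
  · rintro (⟨rfl, hv, h0⟩ | ⟨rfl, hv, h0⟩)
    all_goals
      refine ⟨hv, fun j hj => (hI j e).resolve_right fun hj1 => ?_⟩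
      rcases h.of_val hj1 with rfl | rfl <;> simp_all

/-- A good valued by `i` is either exclusive to `i` or shared with exactly one other vertex, the
other endpoint; hence at most one summand is nonzero. -/
theorem IsEndpointList.val_eq (h : I.IsEndpointList x y) (hI : I.IsBinary) (i : Fin n)
    (e : Fin m) : I.val i e =
      (if I.Excl i e then 1 else 0) + ∑ j, if I.Mutual i j e then 1 else 0 := by
  rcases hI i e with h0 | h1
  · simp [h0, Excl, Mutual]
  · by_cases hex : I.Excl i e
    · have hno : ∀ j, ¬ I.Mutual i j e := ?_
      · simp [h1, hex, hno]
      intro j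
      rintro ⟨hij, _, hj⟩
      rw [hex.2 j hij.symm] at hj
      exact zero_ne_one hj
    · obtain ⟨j, hj⟩ : ∃ j, I.Mutual i j e := by
        by_contra hc
        push Not at hc
        exact hex ⟨h1, fun j hj => (hI j e).resolve_right fun hj1 => hc j ⟨hj.symm, h1, hj1⟩⟩
      rw [if_neg hex, h1, Finset.sum_eq_single j, if_pos hj]
      · intro l _ hl
        rw [if_neg]
        rintro ⟨hil, _, hl1⟩
        rcases h.of_val h1 with rfl | rfl <;> rcases h.of_val hl1 with rfl | rfl <;>
          rcases h.of_val hj.2.2 with h' | h' <;> have := hj.1 <;> simp_all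
      · simp

theorem IsEndpointList.value_eq (h : I.IsEndpointList x y) (hI : I.IsBinary) (i : Fin n)
    (S : Finset (Fin m)) : I.value i S =
      (S.filter (I.Excl i)).card + ∑ j, (S.filter (I.Mutual i j)).card := by
  simp only [value, h.val_eq hI, Finset.card_filter]
  rw [Finset.sum_add_distrib, Finset.sum_comm]

theorem IsEndpointList.hasEFOrientation_iff (h : I.IsEndpointList x y) :
    I.HasEFOrientation ↔ ∃ o : Fin m → Fin n, (∀ e, o e = x e ∨ o e = y e) ∧
      ∀ i j, I.value i (bundle o j) ≤ I.value i (bundle o i) := by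
  constructor
  · rintro ⟨X, ⟨hX, hinc⟩, hef⟩
    choose o ho ho' using hX
    have : ∀ i, bundle o i = X i := by
      intro i
      ext e
      simp only [bundle, Finset.mem_filter_univ]
      constructor
      · rintro rfl; exact ho e
      · intro hi; exact (ho' e i hi).symm
    refine ⟨o, fun e => h.inc_iff.1 (hinc _ e (ho e)), fun i j => ?_⟩
    rw [this, this]
    exact not_lt.1 (hef i j)
  · rintro ⟨o, ho, hef⟩
    refine ⟨bundle o, ⟨fun e => ⟨o e, by simp [bundle], fun i hi => ?_⟩, fun i e he => ?_⟩,
      fun i j => not_lt.2 (hef i j)⟩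
    · simpa [bundle, eq_comm] using hi
    · simp only [bundle, Finset.mem_filter_univ] at he
      rw [h.inc_iff, ← he]
      exact ho e

/-- A good owned by `j` has `j` as an endpoint, so if it is mutual for `i` and `l`, then `l = j`.
Thus envy of `i` towards `j` depends only on the goods between these two. -/
theorem IsEndpointList.value_bundle_of_ne (h : I.IsEndpointList x y) (hI : I.IsBinary)
    {o : Fin m → Fin n} (ho : ∀ e, o e = x e ∨ o e = y e) {i j : Fin n} (hij : i ≠ j) :
    I.value i (bundle o j) = ((bundle o j).filter (I.Excl i)).card + I.share o j i := by
  rw [h.value_eq hI, Finset.sum_eq_single j, share]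
  · congr 2
    exact Finset.filter_congr fun e _ => ⟨Mutual.symm, Mutual.symm⟩
  · intro l _ hl
    rw [Finset.card_eq_zero, Finset.filter_eq_empty_iff]
    intro e he hm
    simp only [bundle, Finset.mem_filter_univ] at he
    subst he
    rcases h.mutual_iff.1 hm with ⟨_, ⟨rfl, rfl⟩ | ⟨rfl, rfl⟩⟩ <;>
      rcases ho e with h' | h' <;> simp_all
  · simp

theorem IsEndpointList.share_add_share (h : I.IsEndpointList x y)
    {o : Fin m → Fin n} (ho : ∀ e, o e = x e ∨ o e = y e) (i j : Fin n) :
    I.share o i j + I.share o j i = I.mult i j := by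
  by_cases hij : i = j
  · subst hij; rw [share_self, mult_self]
  rw [mult, ← Finset.card_filter_add_card_filter_not (p := fun e => o e = i), share, share,
    bundle, bundle, Finset.filter_filter, Finset.filter_filter, Finset.filter_filter,
    Finset.filter_filter]
  congr 2
  · ext e; simp only [Finset.mem_filter_univ]; tauto
  · ext e
    simp only [Finset.mem_filter_univ]
    constructor
    · rintro ⟨rfl, hm⟩; exact ⟨hm.symm, fun h => hij h.symm⟩
    · rintro ⟨hm, hn⟩
      refine ⟨?_, hm.symm⟩
      rcases h.mutual_iff.1 hm with ⟨_, ⟨rfl, rfl⟩ | ⟨rfl, rfl⟩⟩ <;>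
        rcases ho e with h' | h' <;> simp_all

/-- This identity decodes `Needy`: after cancelling the odd degree, its inequality says that twice
the guaranteed value, exclusive goods plus rounded-down halves, is less than `I.mult i j`. -/
theorem sum_mult (i : Fin n) :
    ∑ j, I.mult i j = 2 * ∑ j, I.mult i j / 2 + (I.oddNbrs i).card := by
  rw [oddNbrs, Finset.card_filter, Finset.mul_sum, ← Finset.sum_add_distrib]
  refine Finset.sum_congr rfl fun j _ => ?_
  split_ifs with h
  · rw [Nat.odd_iff] at h; omega
  · rw [Nat.not_odd_iff] at h; omega

/-- A needy vertex that gets the larger part at no odd neighbour envies the vertex `j` witnessing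
its need. So it wins somewhere, and `f` records where; two vertices cannot both get the larger part
of the goods between them. -/
theorem IsEndpointList.solvable_of_hasEFOrientation (h : I.IsEndpointList x y)
    (hI : I.IsBinary) (hef : I.HasEFOrientation) : Solvable I.oddNbrs I.Needy := by
  obtain ⟨o, ho, hef⟩ := h.hasEFOrientation_iff.1 hef
  have key : ∀ i, I.Needy i → ∃ j, j ∈ I.oddNbrs i ∧ I.mult i j < 2 * I.share o i j := by
    rintro i ⟨-, j, hj⟩
    by_contra hc
    push Not at hc
    have hadd := h.share_add_share ho
    have hs := I.sum_mult i
    have hle : I.mult i j / 2 + ∑ l ∈ Finset.univ.erase j, I.mult i l / 2 =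
      ∑ l, I.mult i l / 2 :=
      Finset.add_sum_erase _ (fun l => I.mult i l / 2) (Finset.mem_univ j)
    have hij : i ≠ j := by
      rintro rfl
      rw [mult_self] at hj
      omega
    -- The need inequality leaves room for nothing but the half of `I.mult i j`: all other
    -- multiplicities are at most `1`, and there are no exclusive goods.
    have hz : ∑ l ∈ Finset.univ.erase j, I.mult i l / 2 = 0 := by omega
    -- A multiplicity of `1` is odd, so by `hc` that single good goes to the other vertex.
    have hz' : ∑ l ∈ Finset.univ.erase j, I.share o i l = 0 := by
      rw [Finset.sum_eq_zero_iff] at hz ⊢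
      intro l hl
      have h1 := hz l hl
      have h2 := hadd i l
      have h3 := hc l
      simp only [oddNbrs, Finset.mem_filter_univ] at h3
      rcases Nat.even_or_odd (I.mult i l) with he | ho
      · rw [Nat.even_iff] at he; omega
      · have := h3 ho; rw [Nat.odd_iff] at ho; omega
    have hv := hef i j
    rw [h.value_bundle_of_ne hI ho hij, h.value_eq hI] at hv
    have hsum : ∑ l, ((bundle o i).filter (I.Mutual i l)).card = I.share o i j := by
      rw [← Finset.add_sum_erase _ _ (Finset.mem_univ j)]
      exact (congrArg _ hz').trans (add_zero _)
    have hex : ((bundle o i).filter (I.Excl i)).card ≤ I.excl i :=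
      Finset.card_le_card (Finset.filter_subset_filter _ (Finset.subset_univ _))
    have hodd : Odd (I.mult i j) := by rw [Nat.odd_iff]; omega
    have h2 := hadd i j
    have h3 := hc j (by simpa [oddNbrs] using hodd)
    rw [Nat.odd_iff] at hodd
    omega
  choose! f hf using key
  refine ⟨f, fun i hi => ⟨(hf i hi).1, fun hi' heq => ?_⟩⟩
  have h1 := (hf i hi).2
  have h2 := (hf _ hi').2
  rw [heq, mult_comm] at h2
  have h3 := h.share_add_share ho i (f i)
  omega

/-- Goods shared by two vertices can be divided in any prescribed proportion. -/
theorem exists_split (w : Fin n → Fin n → ℕ) (hw : ∀ i j, i ≠ j → w i j + w j i = I.mult i j) :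
    ∃ S : Fin n → Fin n → Finset (Fin m), ∀ i j, i ≠ j →
      (S i j).card = w i j ∧ (∀ e ∈ S i j, I.Mutual i j e) ∧
      ∀ e, I.Mutual i j e → (e ∈ S j i ↔ e ∉ S i j) := by
  have : ∀ i j, ∃ C : Finset (Fin m), i ≠ j →
      C ⊆ Finset.univ.filter (I.Mutual i j) ∧ C.card = w i j := by
    intro i j
    by_cases hij : i = j
    · exact ⟨∅, fun h => absurd hij h⟩
    · obtain ⟨C, h⟩ := Finset.exists_subset_card_eq
        (s := Finset.univ.filter (I.Mutual i j)) (n := w i j)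
        (by have := hw i j hij; rw [mult] at this; omega)
      exact ⟨C, fun _ => h⟩
  choose C hC using this
  refine ⟨fun i j => if i < j then C i j else Finset.univ.filter (I.Mutual i j) \ C j i,
    fun i j hij => ?_⟩
  have h1 := hC i j hij
  have h2 := hC j i hij.symm
  have hwij := hw i j hij
  dsimp only
  rcases lt_or_gt_of_ne hij with hlt | hlt
  · rw [if_pos hlt, if_neg hlt.not_gt]
    refine ⟨h1.2, fun e he => (Finset.mem_filter.1 (h1.1 he)).2, fun e he => ?_⟩
    simpa using fun _ => he.symm
  · rw [if_neg hlt.not_gt, if_pos hlt]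
    have hsub : C j i ⊆ Finset.univ.filter (I.Mutual i j) := by
      intro e he
      have := h2.1 he
      simp only [Finset.mem_filter_univ] at this ⊢
      exact this.symm
    refine ⟨?_, fun e he => ?_, fun e he => ?_⟩
    · rw [Finset.card_sdiff_of_subset hsub, h2.2]
      rw [mult] at hwij
      omega
    · exact (Finset.mem_filter_univ _).1 (Finset.mem_sdiff.1 he).1
    · simp [he]

/-- Exclusive goods go to their only admirer and mutual goods follow the sets of `exists_split`. The
classes are disjoint, so the requirements do not interfere; a good that nobody values goes to `x e`.
-/
theorem IsEndpointList.exists_owner (h : I.IsEndpointList x y)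
    (w : Fin n → Fin n → ℕ) (hw : ∀ i j, i ≠ j → w i j + w j i = I.mult i j) :
    ∃ o : Fin m → Fin n, (∀ e, o e = x e ∨ o e = y e) ∧ (∀ i e, I.Excl i e → o e = i) ∧
      ∀ i j, i ≠ j → I.share o i j = w i j := by
  obtain ⟨S, hS⟩ := exists_split w hw
  refine ⟨fun e => if I.Excl (y e) e then y e else
    if I.Excl (x e) e then x e else if e ∈ S (y e) (x e) then y e else x e, ?_, ?_, ?_⟩
  · intro e
    dsimp only
    split_ifs <;> simp
  · intro i e he
    dsimp only
    rcases h.of_val he.1 with rfl | rfl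
    · rw [if_neg, if_pos he]
      intro hy
      have := hy.2 _ (h.ne e)
      rw [he.1] at this
      exact one_ne_zero this
    · rw [if_pos he]
  · intro i j hij
    obtain ⟨h1, h2, h3⟩ := hS i j hij
    rw [← h1, share, bundle, Finset.filter_filter]
    congr 1
    ext e
    simp only [Finset.mem_filter_univ]
    have hnex : I.Mutual i j e → ∀ l, ¬ I.Excl l e := by
      intro hm l hl
      by_cases hli : l = i
      · have := hl.2 j (fun h => hij (hli.symm.trans h.symm))
        rw [hm.2.2] at this
        exact one_ne_zero this
      · have := hl.2 i (Ne.symm hli)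
        rw [hm.2.1] at this
        exact one_ne_zero this
    have hne := h.ne e
    have key : I.Mutual i j e → ((if I.Excl (y e) e then y e else
        if I.Excl (x e) e then x e else if e ∈ S (y e) (x e) then y e else x e) = i ↔
          e ∈ S i j) := by
      intro hm
      rw [if_neg (hnex hm _), if_neg (hnex hm _)]
      rcases h.mutual_iff.1 hm with ⟨_, ⟨rfl, rfl⟩ | ⟨rfl, rfl⟩⟩
      · have := h3 e hm
        split_ifs with h'
        · exact ⟨fun h => absurd h.symm hne, fun h => absurd h (this.1 h')⟩
        · exact ⟨fun _ => by tauto, fun _ => rfl⟩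
      · split_ifs with h'
        · exact ⟨fun _ => h', fun _ => rfl⟩
        · exact ⟨fun h => absurd h hne, fun h => absurd h h'⟩
    constructor
    · rintro ⟨ho, hm⟩
      exact (key hm).1 ho
    · intro he
      exact ⟨(key (h2 e he)).2 he, h2 e he⟩

/-- Split all mutual goods evenly, with the extra good of an odd pair going to the needy vertex that
chose this pair. A needy vertex then gains one unit over the rounded-down halves, and the others are
content without it. -/
theorem IsEndpointList.hasEFOrientation_of_solvable (h : I.IsEndpointList x y)
    (hI : I.IsBinary) (hs : Solvable I.oddNbrs I.Needy) : I.HasEFOrientation := by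
  classical
  obtain ⟨f, hf⟩ := hs
  -- The order on vertices breaks ties for pairs that no needy vertex has chosen.
  let win : Fin n → Fin n → Prop := fun i j =>
    (I.Needy i ∧ f i = j) ∨ (¬ (I.Needy j ∧ f j = i) ∧ i < j)
  have hwin : ∀ i j, i ≠ j → (win i j ↔ ¬ win j i) := by
    intro i j hij
    have h1 : I.Needy i → f i = j → I.Needy j → f j ≠ i := by
      rintro hi rfl; exact (hf i hi).2
    have h2 : i < j ↔ ¬ j < i := by
      rw [not_lt]; exact ⟨le_of_lt, fun h => lt_of_le_of_ne h hij⟩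
    simp only [win]
    tauto
  let w : Fin n → Fin n → ℕ := fun i j =>
    I.mult i j / 2 + if Odd (I.mult i j) ∧ win i j then 1 else 0
  obtain ⟨o, ho, hex, hsh⟩ := h.exists_owner w (by
    intro i j hij
    have := hwin i j hij
    simp only [w, mult_comm j i]
    rcases Nat.even_or_odd (I.mult i j) with he | ho
    · rw [if_neg (fun h => Nat.not_odd_iff_even.2 he h.1),
        if_neg (fun h => Nat.not_odd_iff_even.2 he h.1)]
      rw [Nat.even_iff] at he
      omega
    · have hm := Nat.odd_iff.1 ho
      by_cases hwi : win i j
      · rw [if_pos ⟨ho, hwi⟩, if_neg (fun h => this.1 hwi h.2)]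
        omega
      · rw [if_neg (fun h => hwi h.2), if_pos ⟨ho, by tauto⟩]
        omega)
  refine h.hasEFOrientation_iff.2 ⟨o, ho, fun i j => ?_⟩
  by_cases hij : i = j
  · rw [hij]
  have hself : ∀ l, I.share o i l = if i = l then 0 else w i l := by
    intro l
    split_ifs with hl
    · subst hl; exact share_self o i
    · exact hsh i l hl
  have hhalf : ∀ l, I.mult i l / 2 ≤ I.share o i l := by
    intro l
    rw [hself]
    split_ifs with hl
    · subst hl; rw [mult_self]
    · exact Nat.le_add_right _ _
  rw [h.value_bundle_of_ne hI ho hij, h.value_eq hI, hsh j i (Ne.symm hij)]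
  have h0 : ((bundle o j).filter (I.Excl i)).card = 0 := by
    rw [Finset.card_eq_zero, Finset.filter_eq_empty_iff]
    intro e he hm
    simp only [bundle, Finset.mem_filter_univ] at he
    exact hij ((hex i e hm).symm.trans he)
  have h1 : ((bundle o i).filter (I.Excl i)).card = I.excl i := by
    unfold excl
    congr 1
    ext e
    simp only [bundle, Finset.mem_filter, Finset.mem_univ, true_and]
    exact ⟨fun h => h.2, fun h => ⟨hex i e h, h⟩⟩
  rw [h0, h1, zero_add]
  change w j i ≤ I.excl i + ∑ l, I.share o i l
  have hsum : ∑ l, I.mult i l / 2 ≤ ∑ l, I.share o i l :=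
    Finset.sum_le_sum fun l _ => hhalf l
  have hj : I.mult i j / 2 ≤ ∑ l, I.mult i l / 2 :=
    Finset.single_le_sum (f := fun l => I.mult i l / 2) (fun _ _ => Nat.zero_le _)
      (Finset.mem_univ j)
  simp only [w, mult_comm j i]
  split_ifs with hw
  · by_cases hn : I.Needy i
    · have hfi := (hf i hn).1
      have hodd : Odd (I.mult i (f i)) := by simpa [oddNbrs] using hfi
      have hne : i ≠ f i := by
        intro heq
        rw [← heq, mult_self] at hodd
        exact absurd hodd (by decide)
      have : ∑ l, I.mult i l / 2 < ∑ l, I.share o i l := by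
        refine Finset.sum_lt_sum (fun l _ => hhalf l) ⟨f i, Finset.mem_univ _, ?_⟩
        rw [hself, if_neg hne]
        simp only [w]
        rw [if_pos ⟨hodd, .inl ⟨hn, rfl⟩⟩]
        omega
      omega
    · have hne : (I.oddNbrs i).Nonempty := ⟨j, by simpa [oddNbrs] using hw.1⟩
      have : ¬ ∃ j, 2 * I.excl i + ∑ l, I.mult i l < I.mult i j + (I.oddNbrs i).card :=
        fun h => hn ⟨hne, h⟩
      push Not at this
      have h2 := this j
      have h3 := I.sum_mult i
      have h4 := Nat.odd_iff.1 hw.1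
      omega
  · omega

theorem IsEndpointList.hasEFOrientation_iff_solvable (h : I.IsEndpointList x y)
    (hI : I.IsBinary) : I.HasEFOrientation ↔ Solvable I.oddNbrs I.Needy :=
  ⟨h.solvable_of_hasEFOrientation hI, h.hasEFOrientation_of_solvable hI⟩

end EFInstance

/-! ### Solving the choice of edges: leaf removal and Hall's theorem. -/

section Peeling

variable {α : Type*} {N : α → Finset α} {U : α → Prop}

theorem not_solvable_of_empty {u : α} (hu : U u) (h : N u = ∅) : ¬ Solvable N U := by
  rintro ⟨f, hf⟩
  simpa [h] using (hf u hu).1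

theorem Solvable.congr {N' : α → Finset α} {U' : α → Prop} (hU : ∀ u, U u ↔ U' u)
    (hN : ∀ u, U u → N u = N' u) : Solvable N U ↔ Solvable N' U' := by
  refine exists_congr fun f => forall_congr' fun u => ?_
  rw [hU, hU]
  refine imp_congr_right fun hu => ?_
  rw [hN u ((hU u).2 hu)]

/-- The leaf `u` is forced to take its only edge, so `w` may not take it. No other vertex has an
edge to `u`, hence any solution restricts to the graph without `u`, and any solution there extends
by `u ↦ w`. -/
theorem solvable_iff_of_leaf [DecidableEq α] (hsym : ∀ u v, v ∈ N u → u ∈ N v)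
    (hirr : ∀ u, u ∉ N u) {u w : α} (hu : U u) (hw : N u = {w}) :
    Solvable N U ↔ Solvable (fun v => (N v).erase u) (fun v => U v ∧ v ≠ u) := by
  have hwu : w ≠ u := by
    rintro rfl
    exact hirr w (by simp [hw])
  constructor
  · rintro ⟨f, hf⟩
    refine ⟨f, fun v ⟨hv, hvu⟩ => ⟨Finset.mem_erase.2 ⟨fun hfv => ?_, (hf v hv).1⟩,
      fun h => (hf v hv).2 h.1⟩⟩
    have h1 := hsym _ _ (hf v hv).1
    rw [hfv, hw, Finset.mem_singleton] at h1
    have h2 := (hf u hu).1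
    rw [hw, Finset.mem_singleton] at h2
    refine (hf v hv).2 (hfv ▸ hu) ?_
    rw [hfv, h2, h1]
  · rintro ⟨f, hf⟩
    refine ⟨Function.update f u w, fun v hv => ?_⟩
    by_cases hvu : v = u
    · subst hvu
      rw [Function.update_self, Function.update_of_ne hwu]
      exact ⟨by simp [hw], fun h => (Finset.mem_erase.1 (hf w ⟨h, hwu⟩).1).1⟩
    · obtain ⟨h1, h2⟩ := hf v ⟨hv, hvu⟩
      obtain ⟨h3, h4⟩ := Finset.mem_erase.1 h1
      rw [Function.update_of_ne hvu, Function.update_of_ne h3]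
      exact ⟨h4, fun h => h2 ⟨h, h3⟩⟩

/-- Hall's condition by double counting: each vertex of `s` sees at least two edges, and each edge
is seen by at most its two ends. Distinct edges for distinct vertices exclude `f (f u) = u`, since
both would then hold the same edge. -/
theorem solvable_of_two_le_card [DecidableEq α] (hirr : ∀ u, u ∉ N u) (s : Finset α)
    (hs : ∀ u ∈ s, 2 ≤ (N u).card) : Solvable N (· ∈ s) := by
  let t : s → Finset (Sym2 α) := fun u => (N u).image fun w => s(u.1, w)
  have hall : ∀ s' : Finset s, s'.card ≤ (s'.biUnion t).card := by
    intro s'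
    refine Nat.le_of_mul_le_mul_right (c := 2) ?_ two_pos
    refine Finset.card_mul_le_card_mul (fun u e => e ∈ t u) (fun u hu => ?_) fun e he => ?_
    · have : (t u).card = (N u).card :=
        Finset.card_image_of_injective _ fun a b h => Sym2.congr_right.1 h
      refine (hs u u.2).trans (this.symm.le.trans (Finset.card_le_card fun e he => ?_))
      exact Finset.mem_filter.2 ⟨Finset.mem_biUnion.2 ⟨u, hu, he⟩, he⟩
    · induction e with
      | _ a b =>
        refine le_trans (Finset.card_le_card_of_injOn (t := {a, b}) Subtype.val (fun v hv => ?_)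
          Subtype.val_injective.injOn) Finset.card_le_two
        have hv' := (Finset.mem_filter.1 (Finset.mem_coe.1 hv)).2
        obtain ⟨w, -, hw⟩ := Finset.mem_image.1 hv'
        have : v.1 ∈ s(a, b) := hw ▸ Sym2.mem_mk_left _ _
        simpa using this
  obtain ⟨g, hg, hgt⟩ := (Finset.all_card_le_biUnion_card_iff_exists_injective t).1 hall
  have : ∀ u, ∃ w, ∀ hu : u ∈ s, w ∈ N u ∧ s(u, w) = g ⟨u, hu⟩ := by
    intro u
    by_cases hu : u ∈ s
    · obtain ⟨w, hw, h⟩ := Finset.mem_image.1 (hgt ⟨u, hu⟩)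
      exact ⟨w, fun _ => ⟨hw, h⟩⟩
    · exact ⟨u, fun h => absurd h hu⟩
  choose f hf using this
  refine ⟨f, fun u hu => ⟨(hf u hu).1, fun hfu heq => ?_⟩⟩
  have h1 := (hf u hu).2
  have h2 := (hf _ hfu).2
  rw [heq, Sym2.eq_swap, h1] at h2
  have h3 : u = f u := congrArg Subtype.val (hg h2)
  have h4 := (hf u hu).1
  rw [← h3] at h4
  exact hirr u h4

/-- `Solvable` for vertices `0, …, n - 1`, as natural numbers. -/
theorem solvable_fin_iff {n : ℕ} {N : Fin n → Finset (Fin n)} {U : Fin n → Prop}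
    {N' : ℕ → Finset ℕ} {U' : ℕ → Prop} (hN : ∀ i : Fin n, N' i = (N i).map Fin.valEmbedding)
    (hU : ∀ i : Fin n, U' i ↔ U i) (hlt : ∀ u, U' u → u < n) :
    Solvable N U ↔ Solvable N' U' := by
  constructor
  · rintro ⟨f, hf⟩
    refine ⟨fun u => if h : u < n then f ⟨u, h⟩ else u, fun u hu => ?_⟩
    have hun := hlt u hu
    obtain ⟨h1, h2⟩ := hf ⟨u, hun⟩ ((hU _).1 hu)
    dsimp only
    rw [dif_pos hun]
    refine ⟨?_, fun h => ?_⟩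
    · have := hN ⟨u, hun⟩
      dsimp only at this
      rw [this, Finset.mem_map]
      exact ⟨_, h1, rfl⟩
    · rw [dif_pos (f ⟨u, hun⟩).2]
      intro heq
      exact h2 ((hU _).1 h) (Fin.ext heq)
  · rintro ⟨f, hf⟩
    have : ∀ i : Fin n, ∃ j : Fin n, U i → f i = j := by
      intro i
      by_cases hi : U i
      · have := (hf i ((hU i).2 hi)).1
        rw [hN, Finset.mem_map] at this
        obtain ⟨j, -, hj⟩ := this
        exact ⟨j, fun _ => hj.symm⟩
      · exact ⟨i, fun h => absurd h hi⟩
    choose g hg using this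
    refine ⟨g, fun i hi => ?_⟩
    obtain ⟨h1, h2⟩ := hf i ((hU i).2 hi)
    rw [hg i hi] at h1 h2
    refine ⟨?_, fun hgi heq => ?_⟩
    · rw [hN, Finset.mem_map] at h1
      obtain ⟨j, hj, hj'⟩ := h1
      rwa [← Fin.ext (show (j : ℕ) = g i from hj')]
    · refine h2 ((hU _).2 hgi) ?_
      rw [hg _ hgi, heq]

end Peeling

/-! ### Entries of odd multiplicity in a list. -/

namespace List

/-- The entries that occur an odd number of times. -/
def oddSet (l : List ℕ) : Finset ℕ := l.toFinset.filter fun j => l.count j % 2 = 1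

theorem mem_oddSet {l : List ℕ} {j : ℕ} : j ∈ l.oddSet ↔ l.count j % 2 = 1 := by
  rw [oddSet, Finset.mem_filter, mem_toFinset, and_iff_right_iff_imp, ← count_pos_iff]
  omega

theorem oddSet_cons_of_mem {l : List ℕ} {a : ℕ} (h : a ∈ l.oddSet) :
    (a :: l).oddSet = l.oddSet.erase a := by
  ext j
  rw [Finset.mem_erase, mem_oddSet, mem_oddSet, count_cons]
  rw [mem_oddSet] at h
  by_cases hj : j = a
  · subst hj; simp; omega
  · have : ¬ a = j := fun h => hj h.symm
    simp [hj, this]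

theorem oddSet_cons_of_notMem {l : List ℕ} {a : ℕ} (h : a ∉ l.oddSet) :
    (a :: l).oddSet = insert a l.oddSet := by
  ext j
  rw [Finset.mem_insert, mem_oddSet, mem_oddSet, count_cons]
  rw [mem_oddSet] at h
  by_cases hj : j = a
  · subst hj; simp; omega
  · have : ¬ a = j := fun h => hj h.symm
    simp [hj, this]

theorem oddSet_congr {l l' : List ℕ} (h : ∀ j, l.count j = l'.count j) :
    l.oddSet = l'.oddSet := by
  ext j
  rw [mem_oddSet, mem_oddSet, h]

theorem card_oddSet_le (l : List ℕ) : l.oddSet.card ≤ l.length :=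
  (Finset.card_filter_le _ _).trans (toFinset_card_le l)

end List

namespace RAM

set_option linter.constructorNameAsVariable false

/-! ## Reading the input -/

/-- `g` holds the linked list of targets `l` that starts at `h`, in cells below `b`. -/
def Chain (b : ℕ) (g : ℕ → ℕ) : ℕ → List ℕ → Prop
  | h, [] => h = 0
  | h, j :: l => 0 < h ∧ h + 2 < b ∧ g h = j ∧ Chain b g (g (h + 2)) l

theorem Chain.congr {b b' : ℕ} {g g' : ℕ → ℕ} {h : ℕ} {l : List ℕ} (hc : Chain b g h l)
    (hb : b ≤ b') (hg : ∀ a < b, g' a = g a) : Chain b' g' h l := by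
  induction l generalizing h with
  | nil => exact hc
  | cons j l ih =>
    obtain ⟨h1, h2, h3, h4⟩ := hc
    refine ⟨h1, by omega, by rw [hg _ (by omega), h3], ?_⟩
    rw [hg _ h2]
    exact ih h4

/-- In the input area `f`, the data of the edge `e` start at `4 * e + 2`. -/
structure IsInput (n m : ℕ) (f : ℕ → ℕ) : Prop where
  fst_lt : ∀ e < m, f (4 * e + 2) < n
  snd_lt : ∀ e < m, f (4 * e + 3) < n
  val_le : ∀ e < m, f (4 * e + 4) ≤ 1
  val_le' : ∀ e < m, f (4 * e + 5) ≤ 1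

/-- The other endpoints of those of the first `e` edges that are incident with `v` and have
value `1` for both endpoints. -/
def targets (f : ℕ → ℕ) : ℕ → ℕ → List ℕ
  | 0, _ => []
  | e + 1, v =>
    (if f (4 * e + 4) + f (4 * e + 5) = 2 ∧ f (4 * e + 3) = v then [f (4 * e + 2)] else []) ++
    ((if f (4 * e + 4) + f (4 * e + 5) = 2 ∧ f (4 * e + 2) = v then [f (4 * e + 3)] else []) ++
      targets f e v)

/-- The contribution of an edge with values `a` and `b` for its endpoints to the slack of the
first endpoint. -/
def gain (a b : ℕ) : ℕ := a + (a - b)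

/-- Among the first `e` edges, those with value `1` for `v` only count twice, and those with
value `1` for `v` and another vertex count once. -/
def slack (f : ℕ → ℕ) (e v : ℕ) : ℕ :=
  ∑ e' ∈ Finset.range e,
    ((if f (4 * e' + 2) = v then gain (f (4 * e' + 4)) (f (4 * e' + 5)) else 0) +
      if f (4 * e' + 3) = v then gain (f (4 * e' + 5)) (f (4 * e' + 4)) else 0)

variable {n m W : ℕ} {f : ℕ → ℕ}

theorem IsInput.slack_le (hf : IsInput n m f) {e : ℕ} (he : e ≤ m) (v : ℕ) :
    slack f e v ≤ 4 * e := by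
  refine (Finset.sum_le_card_nsmul _ _ 4 fun e' he' => ?_).trans (by simp [mul_comm])
  rw [Finset.mem_range] at he'
  have := hf.val_le e' (by omega)
  have := hf.val_le' e' (by omega)
  unfold gain
  split_ifs <;> omega

theorem IsInput.targets_lt (hf : IsInput n m f) {e : ℕ} (he : e ≤ m) (v : ℕ) :
    ∀ j ∈ targets f e v, j < n := by
  induction e with
  | zero => simp [targets]
  | succ e ih =>
    have h1 := hf.fst_lt e (by omega)
    have h2 := hf.snd_lt e (by omega)
    intro j hj
    simp only [targets, List.mem_append] at hj
    rcases hj with hj | hj | hj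
    · split_ifs at hj <;> simp_all
    · split_ifs at hj <;> simp_all
    · exact ih (by omega) j hj

/-- Each edge adds at most one entry to the lists of each of its ends. This makes the evaluation of
all vertices linear. -/
theorem sum_length_targets_le (f : ℕ → ℕ) (n e : ℕ) :
    ∑ v ∈ Finset.range n, (targets f e v).length ≤ 2 * e := by
  induction e with
  | zero => simp [targets]
  | succ e ih =>
    simp only [targets, List.length_append, Finset.sum_add_distrib]
    have key : ∀ (P : Prop) [Decidable P] (a b : ℕ),
        ∑ v ∈ Finset.range n, (if P ∧ a = v then [b] else []).length ≤ 1 := by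
      intro P _ a b
      calc _ ≤ ∑ v ∈ Finset.range n, if a = v then 1 else 0 := by
            refine Finset.sum_le_sum fun v _ => ?_
            split_ifs <;> simp_all
        _ ≤ 1 := by
            rw [Finset.sum_ite_eq]
            split_ifs <;> omega
    have h1 := key (f (4 * e + 4) + f (4 * e + 5) = 2) (f (4 * e + 3)) (f (4 * e + 2))
    have h2 := key (f (4 * e + 4) + f (4 * e + 5) = 2) (f (4 * e + 2)) (f (4 * e + 3))
    omega

/-- The registers that keep their value after the start. -/
structure Std (n m : ℕ) (r : Reg → ℕ) : Prop where
  zero : r .zero = 0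
  one : r .one = 1
  two : r .two = 2
  n : r .n = n
  fin : r .fin = 4 * m + 2

open Cmd in
/-- Read an edge. -/
def edgeCmd : Cmd :=
  ldI .x .p ;; add .q .p .one ;; ldI .y .q ;; add .q .q .one ;; ldI .a .q ;;
  add .t .q .one ;; ldI .b .t ;;
  ldA .s .slack .x ;; add .s .s .a ;; sub .d .a .b ;; add .s .s .d ;; stA .slack .x .s ;;
  ldA .s .slack .y ;; add .s .s .b ;; sub .d .b .a ;; add .s .s .d ;; stA .slack .y .s ;;
  add .d .a .b ;;
  ite (.eq .d .two)
    (ldA .s .head .x ;; stI .t .s ;; sub .t .t .two ;; stA .head .x .t ;;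
      ldA .s .head .y ;; stI .q .s ;; stA .head .y .p)
    skip ;;
  add .p .p .two ;; add .p .p .two

/-- The situation after `e` edges. -/
structure ReadInv (n m : ℕ) (f : ℕ → ℕ) (e : ℕ) (σ : AState) : Prop where
  std : Std n m σ.reg
  le : e ≤ m
  p : σ.reg .p = 4 * e + 2
  inp : ∀ l, 4 * e + 2 ≤ l → σ.inp l = f l
  slack : σ.arr .slack = slack f e
  chain : ∀ v, Chain (4 * e + 2) σ.inp (σ.arr .head v) (targets f e v)
  cnt : σ.arr .cnt = 0
  par : σ.arr .par = 0
  deg : σ.arr .deg = 0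

/-- The four cells of an edge become two list nodes: the endpoint cells `b` and `b + 1` remain as
targets, and the value cells two places further, no longer needed, become the links. Address `0` can
serve as the null pointer since nodes start at address `2`. -/
theorem chain_insert {b : ℕ} {g hd : ℕ → ℕ} {T : ℕ → List ℕ} (hb : 0 < b) (x y : ℕ)
    (hT : ∀ v, Chain b g (hd v) (T v)) (v : ℕ) :
    Chain (b + 4)
      (Function.update (Function.update g (b + 3) (hd x)) (b + 2)
        (if y = x then b + 1 else hd y))
      (Function.update (Function.update hd x (b + 1)) y b v)
      ((if y = v then [g b] else []) ++ ((if x = v then [g (b + 1)] else []) ++ T v)) := by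
  set g' := Function.update (Function.update g (b + 3) (hd x)) (b + 2)
    (if y = x then b + 1 else hd y) with hg'
  have hlt : ∀ a < b + 2, g' a = g a := by
    intro a ha
    rw [hg', Function.update_of_ne (by omega), Function.update_of_ne (by omega)]
  have h2 : g' (b + 2) = if y = x then b + 1 else hd y := Function.update_self ..
  have h3 : g' (b + 3) = hd x := by
    rw [hg', Function.update_of_ne (by omega), Function.update_self]
  have hold : ∀ v, Chain (b + 4) g' (hd v) (T v) := fun v =>
    (hT v).congr (by omega) fun a ha => hlt a (by omega)
  have hx : Chain (b + 4) g' (b + 1) (g (b + 1) :: T x) :=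
    ⟨by omega, by omega, hlt _ (by omega), by rw [h3]; exact hold x⟩
  by_cases hyv : y = v
  · subst hyv
    rw [Function.update_self, if_pos rfl]
    refine ⟨hb, by omega, hlt _ (by omega), ?_⟩
    rw [h2]
    by_cases hxy : x = y
    · subst hxy
      simpa using hx
    · rw [if_neg (Ne.symm hxy), if_neg hxy]
      exact hold y
  · rw [Function.update_of_ne (Ne.symm hyv), if_neg hyv]
    by_cases hxv : x = v
    · subst hxv
      simpa using hx
    · rw [Function.update_of_ne (Ne.symm hxv), if_neg hxv]
      exact hold v

theorem update_update_eq_add (s : ℕ → ℕ) (x y g g' : ℕ) :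
    Function.update (Function.update s x (s x + g)) y ((if y = x then s x + g else s y) + g') =
      fun v => s v + ((if x = v then g else 0) + if y = v then g' else 0) := by
  funext v
  by_cases hy : v = y
  · subst hy
    by_cases hx : v = x
    · subst hx; simp [add_assoc]
    · simp [hx, Ne.symm hx]
  · by_cases hx : v = x
    · subst hx; simp [hy, Ne.symm hy]
    · simp [hx, hy, Ne.symm hx, Ne.symm hy]

theorem runs_edgeCmd (hW : 100 * (n + m + 1) ≤ W) (hf : IsInput n m f) {e : ℕ} {σ : AState}
    (h : ReadInv n m f e σ) (hp : σ.reg .p < σ.reg .fin) :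
    Runs W (4 * m + 2) edgeCmd.prog σ fun t σ' => t ≤ 100 ∧ ReadInv n m f (e + 1) σ' := by
  refine (edgeCmd.runs (Q := ReadInv n m f (e + 1)) ?_).mono
    fun t σ' h => ⟨h.1.trans (by decide), h.2⟩
  have hem : e < m := by
    rw [h.p, h.std.fin] at hp
    omega
  have e2 := h.inp (4 * e + 2) (by omega)
  have e3 := h.inp (4 * e + 3) (by omega)
  have e4 := h.inp (4 * e + 4) (by omega)
  have e5 := h.inp (4 * e + 5) (by omega)
  have h2 := hf.fst_lt e hem
  have h3 := hf.snd_lt e hem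
  have h4 := hf.val_le e hem
  have h5 := hf.val_le' e hem
  have hs := hf.slack_le h.le
  have hs2 := hs (f (4 * e + 2))
  have hs3 := hs (f (4 * e + 3))
  -- The command gets the address of the second endpoint by stepping back from the last cell of the
  -- edge.
  have e53 : 4 * e + 5 - 2 = 4 * e + 3 := by omega
  have hslack := update_update_eq_add (RAM.slack f e) (f (4 * e + 2)) (f (4 * e + 3))
    (gain (f (4 * e + 4)) (f (4 * e + 5))) (gain (f (4 * e + 5)) (f (4 * e + 4)))
  have hsucc : RAM.slack f (e + 1) = _ :=
    funext fun v => Finset.sum_range_succ (fun e' =>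
      ((if f (4 * e' + 2) = v then gain (f (4 * e' + 4)) (f (4 * e' + 5)) else 0) +
      if f (4 * e' + 3) = v then gain (f (4 * e' + 5)) (f (4 * e' + 4)) else 0)) e
  rw [gain, gain] at hslack
  simp only [edgeCmd, Cmd.wp, AState.reg_setReg, AState.inp_setReg, AState.arr_setReg,
    AState.reg_setInp, AState.arr_setInp, AState.reg_setArr, AState.arr_setArr, Function.update_apply, Cond.Holds, reduceCtorEq,
    if_true, if_false, h.p, h.std.one, h.std.two, h.slack, e2, e3, e4, e5, Nat.add_assoc,
    Nat.reduceAdd, e53]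
  and_intros
  all_goals try first | omega | (split_ifs <;> omega)
  · intro h2
    and_intros
    all_goals try omega
    constructor
    · constructor <;> simp [h.std.zero, h.std.one, h.std.two, h.std.n, h.std.fin]
    · omega
    · simp; omega
    · intro l hl
      have := h.inp l (by omega)
      have e1 : ¬ l = 4 * e + 4 := by omega
      have e2 : ¬ l = 4 * e + 5 := by omega
      simp [this, e1, e2]
    · simp [h.slack]
      rw [hslack, hsucc]
      rfl
    · intro v
      have := chain_insert (b := 4 * e + 2) (by omega) (f (4 * e + 2)) (f (4 * e + 3))
        h.chain v
      rw [e2, e3] at this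
      simp [targets, h2]
      exact this
    · simp [h.cnt]
    · simp [h.par]
    · simp [h.deg]
  · intro h2
    and_intros
    all_goals try omega
    constructor
    · constructor <;> simp [h.std.zero, h.std.one, h.std.two, h.std.n, h.std.fin]
    · omega
    · simp; omega
    · intro l hl
      have := h.inp l (by omega)
      simp [this]
    · simp [h.slack]
      rw [hslack, hsucc]
      rfl
    · intro v
      simp [targets, h2]
      exact (h.chain v).congr (by omega) fun _ _ => rfl
    · simp [h.cnt]
    · simp [h.par]
    · simp [h.deg]

/-- Read all edges. -/
def readProg : Prog := .loop (Cond.lt .p .fin).test edgeCmd.prog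

theorem runs_readProg (hW : 100 * (n + m + 1) ≤ W) (hf : IsInput n m f) {σ : AState}
    (h : ReadInv n m f 0 σ) :
    Runs W (4 * m + 2) readProg σ fun t σ' => t ≤ 101 * m + 1 ∧ ReadInv n m f m σ' := by
  refine (Runs.loop (fun k σ => ∃ e, ReadInv n m f e σ ∧ k = 101 * (m - e)) ?_
    ⟨0, h, rfl⟩).mono ?_
  · rintro k σ ⟨e, hi, rfl⟩ hb
    refine (runs_edgeCmd hW hf hi hb).mono fun t σ' ⟨ht, h'⟩ =>
      ⟨_, ⟨e + 1, h', rfl⟩, ?_⟩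
    have := h'.le
    omega
  · rintro t σ' ⟨k, ⟨e, hi, rfl⟩, hb, ht⟩
    have hp : ¬ σ'.reg .p < σ'.reg .fin := hb
    rw [hi.p, hi.std.fin] at hp
    have := hi.le
    obtain rfl : e = m := by omega
    exact ⟨by omega, hi⟩

end RAM

namespace RAM

set_option linter.constructorNameAsVariable false

variable {n m W : ℕ} {f g : ℕ → ℕ}

/-! ## Evaluating the multiplicities -/

theorem length_targets_le (f : ℕ → ℕ) (e v : ℕ) : (targets f e v).length ≤ 2 * e := by
  induction e with
  | zero => simp [targets]
  | succ e ih =>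
    simp only [targets, List.length_append]
    split_ifs <;> simp <;> omega

/-- The vertex `v` needs the larger part of the goods shared with some neighbour. -/
def NeedyAt (f : ℕ → ℕ) (m v : ℕ) : Prop :=
  ∃ j, slack f m v < (targets f m v).count j + (targets f m v).oddSet.card

open Classical in
/-- The degree of a needy vertex, and `0` for other vertices. -/
noncomputable def needyDeg (f : ℕ → ℕ) (m v : ℕ) : ℕ :=
  if NeedyAt f m v then (targets f m v).oddSet.card else 0

/-- The state after the evaluation of `v` vertices, up to scratch memory. -/
structure ListFrame (n m : ℕ) (f g : ℕ → ℕ) (v : ℕ) (σ : AState) : Prop where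
  std : Std n m σ.reg
  i : σ.reg .i = v
  inp : σ.inp = g
  slack : σ.arr .slack = slack f m
  chain : ∀ u, Chain (4 * m + 2) g (σ.arr .head u) (targets f m u)
  deg : ∀ u, σ.arr .deg u = if u < v then needyDeg f m u else 0
  sum_lt : ∀ u < v, σ.arr .sum u < n
  sum : ∀ u < v, σ.arr .sum u ≡ ∑ j ∈ (targets f m u).oddSet, j [MOD n]

/-- The situation after the evaluation of `v` vertices. -/
structure ListInv (n m : ℕ) (f g : ℕ → ℕ) (v : ℕ) (σ : AState) : Prop
    extends ListFrame n m f g v σ where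
  le : v ≤ n
  cnt : σ.arr .cnt = 0
  par : σ.arr .par = 0

/-- The result of counting the entries of `P`. -/
structure Counted (n m : ℕ) (f : ℕ → ℕ) (v : ℕ) (P : List ℕ) (r : Reg → ℕ) : Prop where
  s : r .s = slack f m v
  le_k : ∀ j, P.count j ≤ r .k
  k : ∃ j, r .k = P.count j
  d : r .d = P.oddSet.card
  w_lt : r .w < n
  w : r .w ≡ ∑ j ∈ P.oddSet, j [MOD n]

/-- The situation at the vertex `v` when the entries `P` have been counted and the entries `R`
have not. -/
structure CountInv (n m : ℕ) (f g : ℕ → ℕ) (v : ℕ) (P R : List ℕ) (σ : AState) : Prop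
    extends ListFrame n m f g v σ, Counted n m f v P σ.reg where
  h₀ : σ.reg .h₀ = σ.arr .head v
  h : Chain (4 * m + 2) g (σ.reg .h) R
  perm : (P ++ R).Perm (targets f m v)
  cnt : ∀ j, σ.arr .cnt j = P.count j
  par : ∀ j, σ.arr .par j = P.count j % 2

/-- The situation at the vertex `v` when the entries `R` have not been cleared. -/
structure ClearInv (n m : ℕ) (f g : ℕ → ℕ) (v : ℕ) (P R : List ℕ) (σ : AState) : Prop
    extends ListFrame n m f g v σ, Counted n m f v P σ.reg where
  h : Chain (4 * m + 2) g (σ.reg .h) R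
  lt : ∀ j ∈ R, j < n
  perm : P.Perm (targets f m v)
  cnt : ∀ j, j ∉ R → σ.arr .cnt j = 0
  par : ∀ j, j ∉ R → σ.arr .par j = 0

open Cmd in
/-- Start the evaluation of a vertex. -/
def beginCmd : Cmd :=
  ldA .s .slack .i ;; ldA .h .head .i ;; move .h₀ .h ;; move .k .zero ;; move .d .zero ;;
  move .w .zero

open Cmd in
/-- Count an entry. -/
def countCmd : Cmd :=
  ldI .j .h ;; ldA .c .cnt .j ;; add .c .c .one ;; stA .cnt .j .c ;;
  ite (.lt .k .c) (move .k .c) skip ;;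
  ldA .q .par .j ;;
  ite (.eq .q .zero)
    (stA .par .j .one ;; add .d .d .one ;; add .w .w .j)
    (stA .par .j .zero ;; sub .d .d .one ;; add .w .w .n ;; sub .w .w .j) ;;
  ite (.lt .w .n) skip (sub .w .w .n) ;;
  add .t .h .two ;; ldI .h .t

open Cmd in
/-- Clear the counters of an entry. -/
def clearCmd : Cmd :=
  ldI .j .h ;; stA .cnt .j .zero ;; stA .par .j .zero ;; add .t .h .two ;; ldI .h .t

open Cmd in
/-- Finish the evaluation of a vertex. -/
def endCmd : Cmd :=
  add .t .k .d ;; ite (.lt .s .t) (stA .deg .i .d) skip ;; stA .sum .i .w ;; add .i .i .one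

/-- Evaluate a vertex. -/
def vertexProg : Prog :=
  .seq beginCmd.prog (.seq (.loop (Cond.lt .zero .h).test countCmd.prog)
    (.seq (Cmd.move .h .h₀).prog (.seq (.loop (Cond.lt .zero .h).test clearCmd.prog)
      endCmd.prog)))

theorem runs_beginCmd (hW : 100 * (n + m + 1) ≤ W) {v : ℕ} {σ : AState}
    (h : ListInv n m f g v σ) (hv : v < n) :
    Runs W (4 * m + 2) beginCmd.prog σ fun t σ' => t ≤ 100 ∧
      CountInv n m f g v [] (targets f m v) σ' := by
  refine (beginCmd.runs (Q := CountInv n m f g v [] (targets f m v)) ?_).mono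
    fun t σ' h => ⟨h.1.trans (by decide), h.2⟩
  simp only [beginCmd, Cmd.wp, AState.reg_setReg, AState.arr_setReg, reduceCtorEq,
    if_true, if_false, h.i]
  and_intros
  all_goals try omega
  constructor
  · constructor <;> simp [h.i, h.inp, h.slack, h.chain, h.deg]
    · constructor <;> simp [h.std.zero, h.std.one, h.std.two, h.std.n, h.std.fin]
    · exact h.sum_lt
    · exact h.sum
  all_goals simp [h.std.zero, h.slack, h.cnt, h.par, h.chain]
  · constructor <;> simp [List.oddSet]
    · omega
    · rfl

/-- A further occurrence of `j` toggles its membership in the odd set, so the degree changes by one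
and the sum by `j`. In both cases the new sum stays below `2 * n` before reduction, so one
conditional subtraction of `n` suffices. -/
theorem runs_countCmd (hW : 100 * (n + m + 1) ≤ W) (hf : IsInput n m f) {v : ℕ}
    {P R : List ℕ} {σ : AState}
    (h : CountInv n m f g v P R σ) (hb : σ.reg .zero < σ.reg .h) :
    Runs W (4 * m + 2) countCmd.prog σ fun t σ' => t ≤ 100 ∧ ∃ j R', R = j :: R' ∧
      CountInv n m f g v (j :: P) R' σ' := by
  rw [h.std.zero] at hb
  obtain _ | ⟨j, R⟩ := R
  · exact absurd h.h hb.ne'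
  obtain ⟨-, hh, hj, hc⟩ := h.h
  refine (countCmd.runs (Q := CountInv n m f g v (j :: P) R) ?_).mono
    fun t σ' h => ⟨h.1.trans (by decide), j, R, rfl, h.2⟩
  have hjn : j < n := hf.targets_lt le_rfl v j (h.perm.subset (by simp))
  have hperm : (j :: P ++ R).Perm (targets f m v) := List.perm_middle.symm.trans h.perm
  have hlen := length_targets_le f m v
  have hlen' := hperm.length_eq
  simp only [List.cons_append, List.length_cons, List.length_append] at hlen'
  have hcount : ∀ l, P.count l ≤ P.length := fun l => List.count_le_length
  have hodd := P.card_oddSet_le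
  have hw := h.w_lt
  have hcj := hcount j
  simp only [countCmd, Cmd.wp, AState.reg_setReg, AState.inp_setReg, AState.arr_setReg,
    AState.reg_setArr, AState.inp_setArr, AState.arr_setArr, Cond.Holds, reduceCtorEq,
    if_true, if_false, h.inp, hj, h.cnt, h.par, h.std.one, h.std.two, h.std.zero, h.std.n, h.d]
  -- Common endgame of all execution branches: only these facts about the final state have to be
  -- checked in each branch.
  have hfin : ∀ σ' : AState, Std n m σ'.reg → σ'.reg .i = σ.reg .i → σ'.reg .s = σ.reg .s →
      σ'.reg .h₀ = σ.reg .h₀ → σ'.inp = σ.inp →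
      (∀ k, k ≠ .cnt → k ≠ .par → σ'.arr k = σ.arr k) →
      σ'.reg .h = g (σ.reg .h + 2) → σ'.reg .k = max (σ.reg .k) (P.count j + 1) →
      σ'.reg .d = (j :: P).oddSet.card → σ'.reg .w < n →
      σ'.reg .w ≡ ∑ j ∈ (j :: P).oddSet, j [MOD n] →
      σ'.arr .cnt = Function.update (σ.arr .cnt) j (P.count j + 1) →
      σ'.arr .par = Function.update (σ.arr .par) j ((P.count j + 1) % 2) →
      CountInv n m f g v (j :: P) R σ' := by
    intro σ' hstd hi hs hh₀ hinp harr hh hk hd hw_lt hw hcnt hpar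
    have hcc : ∀ l, (j :: P).count l = if l = j then P.count j + 1 else P.count l := by
      intro l
      by_cases hl : l = j
      · subst hl; simp
      · simp [hl, Ne.symm hl]
    exact {
      std := hstd
      i := hi.trans h.i
      inp := hinp.trans h.inp
      slack := by rw [harr _ (by simp) (by simp), h.slack]
      chain := by rw [harr _ (by simp) (by simp)]; exact h.chain
      deg := by rw [harr _ (by simp) (by simp)]; exact h.deg
      sum_lt := by rw [harr _ (by simp) (by simp)]; exact h.sum_lt
      sum := by rw [harr _ (by simp) (by simp)]; exact h.sum
      s := hs.trans h.s
      le_k := by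
        intro l
        have := h.le_k l
        rw [hk, hcc]
        split_ifs <;> omega
      k := by
        obtain ⟨l, hl⟩ := h.k
        have := h.le_k j
        rw [hk]
        rcases le_total (σ.reg .k) (P.count j + 1) with h' | h'
        · exact ⟨j, by rw [hcc, if_pos rfl, max_eq_right h']⟩
        · refine ⟨l, ?_⟩
          rw [hcc, max_eq_left h', hl, if_neg]
          rintro rfl
          omega
      d := hd
      w_lt := hw_lt
      w := hw
      h₀ := by rw [hh₀, h.h₀, harr _ (by simp) (by simp)]
      h := by rw [hh]; exact hc
      perm := hperm
      cnt := by intro l; rw [hcnt, hcc, Function.update_apply, h.cnt]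
      par := by
        intro l
        rw [hpar, hcc, Function.update_apply, h.par]
        split_ifs <;> rfl }
  have heven : P.count j % 2 = 0 → (j :: P).oddSet.card = P.oddSet.card + 1 ∧
      σ.reg .w + j ≡ ∑ j ∈ (j :: P).oddSet, j [MOD n] := by
    intro h0
    have hmem : j ∉ P.oddSet := by rw [List.mem_oddSet]; omega
    rw [List.oddSet_cons_of_notMem hmem, Finset.card_insert_of_notMem hmem,
      Finset.sum_insert hmem]
    refine ⟨rfl, ?_⟩
    rw [add_comm]
    exact h.w.add_left j
  have hodd' : ¬ P.count j % 2 = 0 → (j :: P).oddSet.card = P.oddSet.card - 1 ∧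
      σ.reg .w + n - j ≡ ∑ j ∈ (j :: P).oddSet, j [MOD n] := by
    intro h0
    have hmem : j ∈ P.oddSet := by rw [List.mem_oddSet]; omega
    rw [List.oddSet_cons_of_mem hmem, Finset.card_erase_of_mem hmem]
    refine ⟨rfl, Nat.ModEq.add_right_cancel' j ?_⟩
    rw [Finset.sum_erase_add _ _ hmem, Nat.sub_add_cancel (by omega)]
    exact (Nat.add_modEq_right).trans h.w
  have hsub : ∀ a b, ¬ a < n → a ≡ b [MOD n] → a - n ≡ b [MOD n] := by
    intro a b ha hab
    refine Nat.ModEq.trans ?_ hab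
    conv_rhs => rw [← Nat.sub_add_cancel (not_lt.1 ha)]
    exact Nat.add_modEq_right.symm
  repeat' first | apply And.intro | intro _
  all_goals try omega
  all_goals
    apply hfin
    · constructor <;> simp [h.std.zero, h.std.one, h.std.two, h.std.n, h.std.fin]
    all_goals try simp; done
    all_goals try (simp; omega)
    all_goals try (intro k hk hk'; simp [hk, hk'])
    all_goals try (simp; congr 1; omega)
    all_goals
      simp only [AState.reg_setReg, AState.reg_setArr, reduceCtorEq, if_true, if_false]
      first
      | exact (heven (by assumption)).2
      | exact (hodd' (by assumption)).2
      | exact hsub _ _ (by assumption) (heven (by assumption)).2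
      | exact hsub _ _ (by assumption) (hodd' (by assumption)).2

theorem runs_clearCmd (hW : 100 * (n + m + 1) ≤ W) {v : ℕ} {P R : List ℕ} {σ : AState}
    (h : ClearInv n m f g v P R σ) (hb : σ.reg .zero < σ.reg .h) :
    Runs W (4 * m + 2) clearCmd.prog σ fun t σ' => t ≤ 100 ∧ ∃ j R', R = j :: R' ∧
      ClearInv n m f g v P R' σ' := by
  rw [h.std.zero] at hb
  obtain _ | ⟨j, R⟩ := R
  · exact absurd h.h hb.ne'
  obtain ⟨-, hh, hj, hc⟩ := h.h
  refine (clearCmd.runs (Q := ClearInv n m f g v P R) ?_).mono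
    fun t σ' h => ⟨h.1.trans (by decide), j, R, rfl, h.2⟩
  have hjn : j < n := h.lt j (by simp)
  simp only [clearCmd, Cmd.wp, AState.reg_setReg, AState.inp_setReg, AState.reg_setArr,
    AState.inp_setArr, reduceCtorEq, if_true, if_false, h.inp, hj, h.std.two, h.std.zero]
  and_intros
  all_goals try omega
  constructor
  · refine ⟨?_, by simp [h.i], by simp [h.inp], by simp [h.slack], by simpa using h.chain,
      by simpa using h.deg, by simpa using h.sum_lt, by simpa using h.sum⟩
    constructor <;> simp [h.std.zero, h.std.one, h.std.two, h.std.n, h.std.fin]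
  · exact ⟨h.s, h.le_k, h.k, h.d, h.w_lt, h.w⟩
  · simpa using hc
  · exact fun l hl => h.lt l (by simp [hl])
  · exact h.perm
  · intro l hl
    have := h.cnt l
    by_cases hlj : l = j <;> simp_all
  · intro l hl
    have := h.par l
    by_cases hlj : l = j <;> simp_all

theorem runs_endCmd (hW : 100 * (n + m + 1) ≤ W) {v : ℕ} {P : List ℕ} {σ : AState}
    (h : ClearInv n m f g v P [] σ) (hv : v < n) :
    Runs W (4 * m + 2) endCmd.prog σ fun t σ' => t ≤ 100 ∧ ListInv n m f g (v + 1) σ' := by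
  refine (endCmd.runs (Q := ListInv n m f g (v + 1)) ?_).mono
    fun t σ' h => ⟨h.1.trans (by decide), h.2⟩
  have hlen := length_targets_le f m v
  rw [← h.perm.length_eq] at hlen
  have hd := P.card_oddSet_le
  rw [← h.d] at hd
  have hk : σ.reg .k ≤ P.length := by
    obtain ⟨j, hj⟩ := h.k
    rw [hj]
    exact List.count_le_length
  have hset : P.oddSet = (targets f m v).oddSet := List.oddSet_congr fun j => h.perm.count_eq j
  -- The best `j` is one of largest multiplicity, so comparing with the maximum `k` decides the
  -- existential statement.
  have hneedy : slack f m v < σ.reg .k + σ.reg .d ↔ NeedyAt f m v := by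
    rw [NeedyAt, ← hset, ← h.d]
    constructor
    · intro hlt
      obtain ⟨j, hj⟩ := h.k
      exact ⟨j, by rw [← h.perm.count_eq j, ← hj]; exact hlt⟩
    · rintro ⟨j, hj⟩
      rw [← h.perm.count_eq j] at hj
      have := h.le_k j
      omega
  have hfin : ∀ σ' : AState, Std n m σ'.reg → σ'.reg .i = v + 1 → σ'.inp = σ.inp →
      (∀ k, k ≠ .deg → k ≠ .sum → σ'.arr k = σ.arr k) →
      σ'.arr .deg = Function.update (σ.arr .deg) v (needyDeg f m v) →
      σ'.arr .sum = Function.update (σ.arr .sum) v (σ.reg .w) →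
      ListInv n m f g (v + 1) σ' := by
    intro σ' hstd hi hinp harr hdeg hsum
    exact {
      std := hstd
      i := hi
      inp := hinp.trans h.inp
      slack := by rw [harr _ (by simp) (by simp), h.slack]
      chain := by rw [harr _ (by simp) (by simp)]; exact h.chain
      deg := by
        intro u
        rw [hdeg, Function.update_apply, h.deg]
        split_ifs <;> first | rfl | omega | simp_all
      sum_lt := by
        intro u hu
        rw [hsum, Function.update_apply]
        split_ifs with huv
        · exact h.w_lt
        · exact h.sum_lt u (by omega)
      sum := by
        intro u hu
        rw [hsum, Function.update_apply]
        split_ifs with huv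
        · rw [huv, ← hset]
          exact h.w
        · exact h.sum u (by omega)
      le := hv
      cnt := by rw [harr _ (by simp) (by simp)]; exact funext fun j => h.cnt j (by simp)
      par := by rw [harr _ (by simp) (by simp)]; exact funext fun j => h.par j (by simp) }
  simp only [endCmd, Cmd.wp, AState.reg_setReg, AState.reg_setArr, Cond.Holds,
    reduceCtorEq, if_true, if_false, h.i, h.std.one, h.s]
  repeat' first | apply And.intro | intro _
  all_goals try omega
  all_goals
    apply hfin
    · constructor <;> simp [h.std.zero, h.std.one, h.std.two, h.std.n, h.std.fin]
    all_goals try simp; done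
    all_goals try (intro k hk hk'; simp [hk, hk'])
  · simp only [AState.arr_setReg, AState.arr_setArr, reduceCtorEq, if_true, if_false]
    rw [needyDeg, if_pos (hneedy.1 (by assumption)), ← hset, h.d]
  · simp only [AState.arr_setReg, AState.arr_setArr, reduceCtorEq, if_false]
    rw [needyDeg, if_neg (fun hn => by have := hneedy.2 hn; contradiction), eq_comm,
      Function.update_eq_self_iff, h.deg, if_neg (lt_irrefl v)]

/-- The list is traversed twice, to count and to clear. Clearing only the touched counters keeps the
cost proportional to the length of the list rather than to `n`. -/
theorem runs_vertexProg (hW : 100 * (n + m + 1) ≤ W) (hf : IsInput n m f) {v : ℕ}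
    {σ : AState} (h : ListInv n m f g v σ) (hv : v < n) :
    Runs W (4 * m + 2) vertexProg σ fun t σ' =>
      t ≤ 203 + 202 * (targets f m v).length ∧ ListInv n m f g (v + 1) σ' := by
  refine (runs_beginCmd hW h hv).seq fun t₁ σ₁ ⟨ht₁, h₁⟩ => ?_
  refine (Runs.loop (fun k σ => ∃ P R, CountInv n m f g v P R σ ∧ k = 101 * R.length) ?_
    ⟨_, _, h₁, rfl⟩).seq fun t₂ σ₂ h₂ => ?_
  · rintro k σ ⟨P, R, hi, rfl⟩ hb
    refine (runs_countCmd hW hf hi hb).mono fun t σ' ⟨ht, j, R', hR, h'⟩ =>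
      ⟨_, ⟨_, R', h', rfl⟩, ?_⟩
    rw [hR, List.length_cons]
    omega
  obtain ⟨k₂, ⟨P, R, h₂, rfl⟩, hb₂, ht₂⟩ := h₂
  have hR : R = [] := by
    obtain _ | ⟨j, R⟩ := R
    · rfl
    · refine absurd h₂.h.1 ?_
      rw [← h₂.std.zero]
      exact hb₂
  subst hR
  have hperm : P.Perm (targets f m v) := by simpa using h₂.perm
  refine ((Cmd.move .h .h₀).runs (Q := ClearInv n m f g v P (targets f m v)) ?_).seq
    fun t₃ σ₃ ⟨ht₃, h₃⟩ => ?_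
  · have hnm : ∀ j, j ∉ targets f m v → P.count j = 0 := fun j hj => by
      rw [hperm.count_eq, List.count_eq_zero]; exact hj
    refine ⟨⟨?_, h₂.i, h₂.inp, h₂.slack, h₂.chain, h₂.deg, h₂.sum_lt, h₂.sum⟩,
      ⟨h₂.s, h₂.le_k, h₂.k, h₂.d, h₂.w_lt, h₂.w⟩, ?_, hf.targets_lt le_rfl v, hperm,
      fun j hj => ?_, fun j hj => ?_⟩
    · constructor <;> simp [h₂.std.zero, h₂.std.one, h₂.std.two, h₂.std.n, h₂.std.fin]
    · simpa [h₂.h₀] using h₂.chain v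
    · simp [h₂.cnt, hnm j hj]
    · simp [h₂.par, hnm j hj]
  refine (Runs.loop (fun k σ => ∃ R, ClearInv n m f g v P R σ ∧ k = 101 * R.length) ?_
    ⟨_, h₃, rfl⟩).seq fun t₄ σ₄ h₄ => ?_
  · rintro k σ ⟨R, hi, rfl⟩ hb
    refine (runs_clearCmd hW hi hb).mono fun t σ' ⟨ht, j, R', hR, h'⟩ =>
      ⟨_, ⟨R', h', rfl⟩, ?_⟩
    rw [hR, List.length_cons]
    omega
  obtain ⟨k₄, ⟨R, h₄, rfl⟩, hb₄, ht₄⟩ := h₄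
  have hR : R = [] := by
    obtain _ | ⟨j, R⟩ := R
    · rfl
    · refine absurd h₄.h.1 ?_
      rw [← h₄.std.zero]
      exact hb₄
  subst hR
  refine (runs_endCmd hW h₄ hv).mono fun t₅ σ₅ ⟨ht₅, h₅⟩ => ⟨?_, h₅⟩
  have : (Cmd.move .h .h₀).cost = 1 := rfl
  omega

/-- Evaluate all vertices. -/
def evalProg : Prog := .loop (Cond.lt .i .n).test vertexProg

theorem runs_evalProg (hW : 100 * (n + m + 1) ≤ W) (hf : IsInput n m f) {σ : AState}
    (h : ListInv n m f g 0 σ) :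
    Runs W (4 * m + 2) evalProg σ fun t σ' =>
      t ≤ 204 * n + 404 * m + 1 ∧ ListInv n m f g n σ' := by
  refine (Runs.loop (fun k σ => ∃ v, ListInv n m f g v σ ∧
    -- The potential is the total cost of the remaining vertices, each including one unit for the
    -- loop test.
    k = ∑ u ∈ Finset.Ico v n, (204 + 202 * (targets f m u).length)) ?_ ⟨0, h, rfl⟩).mono ?_
  · rintro k σ ⟨v, hi, rfl⟩ hb
    have hv : v < n := by
      have : σ.reg .i < σ.reg .n := hb
      rwa [hi.i, hi.std.n] at this
    refine (runs_vertexProg hW hf hi hv).mono fun t σ' ⟨ht, h'⟩ => ⟨_, ⟨v + 1, h', rfl⟩, ?_⟩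
    rw [Finset.sum_eq_sum_Ico_succ_bot hv]
    omega
  · rintro t σ' ⟨k, ⟨v, hi, rfl⟩, hb, ht⟩
    have hv : ¬ v < n := by
      have : ¬ σ'.reg .i < σ'.reg .n := hb
      rwa [hi.i, hi.std.n] at this
    obtain rfl : v = n := le_antisymm hi.le (not_lt.1 hv)
    refine ⟨?_, hi⟩
    have := sum_length_targets_le f v m
    simp only [Finset.Ico_self, Finset.sum_empty, Nat.Ico_zero_eq_range,
      Finset.sum_add_distrib, ← Finset.mul_sum, Finset.sum_const, Finset.card_range,
      smul_eq_mul] at ht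
    omega

end RAM

/-! ## Peeling -/

/-- `N` gives the neighbours in the current graph on `0, …, n - 1`, and the arrays contain the
degrees and the sums of the neighbours (modulo `n`) of the current vertices; `deg v = 0` for all
other vertices. -/
structure IsPeelState (n : ℕ) (deg sum : ℕ → ℕ) (N : ℕ → Finset ℕ) : Prop where
  symm : ∀ u v, v ∈ N u → u ∈ N v
  irrefl : ∀ u, u ∉ N u
  deg_eq : ∀ v < n, deg v ≠ 0 → deg v = (N v).card
  sum_lt : ∀ v < n, sum v < n
  sum_modEq : ∀ v < n, deg v ≠ 0 → sum v ≡ ∑ j ∈ N v, j [MOD n]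
  lt : ∀ v, ∀ j ∈ N v, j < n

namespace IsPeelState

variable {n : ℕ} {deg sum : ℕ → ℕ} {N : ℕ → Finset ℕ} {u : ℕ}

theorem nbrs_eq (h : IsPeelState n deg sum N) (hu : u < n) (hd : deg u = 1) :
    N u = {sum u} := by
  have h1 : (N u).card = 1 := by rw [← h.deg_eq u hu (by omega), hd]
  obtain ⟨a, ha⟩ := Finset.card_eq_one.1 h1
  have h2 := h.sum_modEq u hu (by omega)
  rw [ha, Finset.sum_singleton] at h2
  have h3 := h.lt u a (by simp [ha])
  rw [ha, h2.eq_of_lt_of_lt (h.sum_lt u hu) h3]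

theorem sum_ne (h : IsPeelState n deg sum N) (hu : u < n) (hd : deg u = 1) : sum u ≠ u := by
  intro heq
  apply h.irrefl u
  rw [h.nbrs_eq hu hd, heq, Finset.mem_singleton]

/-- Removal of a leaf `u`. -/
theorem exists_peel (h : IsPeelState n deg sum N) (hu : u < n) (hd : deg u = 1) {s : ℕ}
    (hs : s < n) (hsmod : s + u ≡ sum (sum u) [MOD n]) :
    ∃ N', IsPeelState n (Function.update (Function.update deg u 0) (sum u) (deg (sum u) - 1))
        (Function.update sum (sum u) s) N' ∧
      if deg (sum u) = 1 then ¬ Solvable N (fun v => v < n ∧ deg v ≠ 0) else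
        (Solvable N (fun v => v < n ∧ deg v ≠ 0) ↔ Solvable N' fun v => v < n ∧
          Function.update (Function.update deg u 0) (sum u) (deg (sum u) - 1) v ≠ 0) := by
  set w := sum u with hw
  have hNu : N u = {w} := h.nbrs_eq hu hd
  have hwu : w ≠ u := h.sum_ne hu hd
  have hwn : w < n := h.sum_lt u hu
  have huw : u ∈ N w := h.symm _ _ (by simp [hNu])
  have hother : ∀ v, v ≠ w → u ∉ N v := fun v hv huv =>
    hv (by simpa [hNu] using h.symm _ _ huv)
  have hleaf := solvable_iff_of_leaf h.symm h.irrefl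
    (U := fun v => v < n ∧ deg v ≠ 0) ⟨hu, by omega⟩ hNu
  -- The deleted vertex also loses its own neighbours, to keep the relation symmetric. Degrees and
  -- sums are only tracked where `deg` is nonzero, so a neighbour that is not needy stays at `0` by
  -- truncated subtraction.
  refine ⟨fun v => if v = u then ∅ else (N v).erase u, ⟨?_, ?_, ?_, ?_, ?_, ?_⟩, ?_⟩
  · intro a b hab
    by_cases ha : a = u
    · simp [ha] at hab
    · rw [if_neg ha, Finset.mem_erase] at hab
      rw [if_neg hab.1, Finset.mem_erase]
      exact ⟨ha, h.symm a b hab.2⟩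
  · intro a
    have := h.irrefl a
    split_ifs <;> simp_all
  · intro v hv hd'
    simp only [Function.update_apply] at hd' ⊢
    split_ifs at hd' ⊢ with h1 h2 h2
    · exact absurd (h1.symm.trans h2) hwu
    · subst h1
      rw [Finset.card_erase_of_mem huw, ← h.deg_eq w hv (by omega)]
    · exact absurd rfl hd'
    · rw [Finset.erase_eq_of_notMem (hother v h1)]
      exact h.deg_eq v hv hd'
  · intro v hv
    rw [Function.update_apply]
    split_ifs
    · exact hs
    · exact h.sum_lt v hv
  · intro v hv hd'
    simp only [Function.update_apply] at hd' ⊢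
    split_ifs at hd' ⊢ with h1 h2 h2
    · exact absurd (h1.symm.trans h2) hwu
    · subst h1
      refine Nat.ModEq.add_right_cancel' u ?_
      rw [Finset.sum_erase_add _ _ huw]
      exact hsmod.trans (h.sum_modEq w hv (by omega))
    · exact absurd rfl hd'
    · rw [Finset.erase_eq_of_notMem (hother v h1)]
      exact h.sum_modEq v hv hd'
  · intro v j hj
    split_ifs at hj
    · simp at hj
    · exact h.lt v j (Finset.mem_of_mem_erase hj)
  · split_ifs with hdw
    -- The neighbour is needy and its only edge was the one taken by `u`.
    · rw [hleaf]
      refine not_solvable_of_empty (u := w) ⟨⟨hwn, by omega⟩, hwu⟩ ?_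
      rw [← Finset.card_eq_zero, Finset.card_erase_of_mem huw, ← h.deg_eq w hwn (by omega), hdw]
    · rw [hleaf]
      refine Solvable.congr (fun v => ?_) fun v hv => by rw [if_neg hv.2]
      simp only [Function.update_apply]
      split_ifs with h1 h2
      · subst h1
        constructor
        · rintro ⟨⟨h1, h2⟩, -⟩
          exact ⟨h1, by omega⟩
        · rintro ⟨h1, h2⟩
          exact ⟨⟨h1, by omega⟩, hwu⟩
      · simp [h2]
      · simp [h2]

theorem solvable (h : IsPeelState n deg sum N) (h1 : ∀ v < n, deg v ≠ 1) :
    Solvable N fun v => v < n ∧ deg v ≠ 0 := by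
  have := solvable_of_two_le_card h.irrefl ((Finset.range n).filter fun v => deg v ≠ 0)
    fun v hv => by
      rw [Finset.mem_filter, Finset.mem_range] at hv
      rw [← h.deg_eq v hv.1 hv.2]
      have := h1 v hv.1
      omega
  simpa using this

end IsPeelState

/-- The number of vertices left. -/
def numNonzero (n : ℕ) (deg : ℕ → ℕ) : ℕ := ((Finset.range n).filter fun v => deg v ≠ 0).card

theorem numNonzero_le (n : ℕ) (deg : ℕ → ℕ) : numNonzero n deg ≤ n :=
  (Finset.card_filter_le _ _).trans (Finset.card_range n).le

/-- This decrease pays for a deletion, whatever happens at the neighbour. -/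
theorem numNonzero_update_lt {n : ℕ} {deg : ℕ → ℕ} {u w : ℕ} (hu : u < n) (hd : deg u = 1)
    (hwu : w ≠ u) :
    numNonzero n (Function.update (Function.update deg u 0) w (deg w - 1)) < numNonzero n deg := by
  refine Finset.card_lt_card (Finset.ssubset_iff_of_subset (fun v hv => ?_) |>.2
    ⟨u, by simp [hu, hd], by simp [hwu.symm]⟩)
  simp only [Finset.mem_filter, Function.update_apply] at hv ⊢
  refine ⟨hv.1, ?_⟩
  have := hv.2
  split_ifs at this with h1 h2
  · subst h1; omega
  · exact absurd rfl this
  · exact this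

namespace RAM

set_option linter.constructorNameAsVariable false

variable {n m W : ℕ} {Q : Prop}

/-- The arrays describe a graph for which the answer is `Q`, unless the answer `0` has been
found; at most `k` vertices are left. -/
structure PeelInv (n m : ℕ) (Q : Prop) (v k : ℕ) (σ : AState) : Prop where
  std : Std n m σ.reg
  i : σ.reg .i = v
  le : v ≤ n
  num_le : numNonzero n (σ.arr .deg) ≤ k
  graph : ∃ N, IsPeelState n (σ.arr .deg) (σ.arr .sum) N ∧
    ((σ.reg .ans = 1 ∧ (Q ↔ Solvable N fun v => v < n ∧ σ.arr .deg v ≠ 0)) ∨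
      (σ.reg .ans = 0 ∧ ¬ Q))

open Cmd in
/-- Remove the leaf `u`. -/
def peelCmd : Cmd :=
  ldA .w .sum .u ;; stA .deg .u .zero ;; ldA .c .deg .w ;;
  ite (.eq .c .one) (move .ans .zero) skip ;;
  sub .c .c .one ;; stA .deg .w .c ;;
  ldA .s .sum .w ;; add .s .s .n ;; sub .s .s .u ;; ite (.lt .s .n) skip (sub .s .s .n) ;;
  stA .sum .w .s ;; move .u .w ;; ldA .c .deg .u

open Cmd in
/-- Start at the vertex `i`. -/
def startCmd : Cmd := move .u .i ;; ldA .c .deg .u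

/-- Remove leaves as long as possible, starting at the vertex `i`. -/
def pathProg : Prog :=
  .seq startCmd.prog (.seq (.loop (Cond.eq .c .one).test peelCmd.prog)
    (Cmd.add .i .i .one).prog)

/-- The situation when `u` is the only vertex up to `v` that may be a leaf. -/
structure PathInv (n m : ℕ) (Q : Prop) (v k : ℕ) (σ : AState) : Prop
    extends PeelInv n m Q v k σ where
  u : σ.reg .u < n
  c : σ.reg .c = σ.arr .deg (σ.reg .u)
  ne_one : ∀ u < v + 1, u ≠ σ.reg .u → σ.arr .deg u ≠ 1

/-- Only the degree of the neighbour `w` can become `1`, so `w` is the next candidate and no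
worklist is needed. After a failure the peeling simply continues; the invariant then only keeps the
answer `0` and a valid graph. -/
theorem runs_peelCmd (hW : 100 * (n + m + 1) ≤ W) {v k : ℕ} {σ : AState}
    (h : PathInv n m Q v k σ) (hb : σ.reg .c = σ.reg .one) :
    Runs W (4 * m + 2) peelCmd.prog σ fun t σ' => t ≤ 100 ∧ 0 < k ∧
      PathInv n m Q v (k - 1) σ' := by
  rw [h.std.one, h.c] at hb
  obtain ⟨N, hN, hans⟩ := h.graph
  have hun := h.u
  have hwu := hN.sum_ne hun hb
  have hwn := hN.sum_lt _ hun
  have hwwn := hN.sum_lt _ hwn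
  have hnum := numNonzero_update_lt hun hb hwu
  have hk := h.num_le
  refine (peelCmd.runs (Q := PathInv n m Q v (k - 1)) ?_).mono
    fun t σ' h => ⟨h.1.trans (by decide), by omega, h.2⟩
  have hfin : ∀ σ' : AState, Std n m σ'.reg → σ'.reg .i = σ.reg .i →
      σ'.reg .u = σ.arr .sum (σ.reg .u) →
      σ'.reg .c = σ.arr .deg (σ.arr .sum (σ.reg .u)) - 1 →
      σ'.arr .deg = Function.update (Function.update (σ.arr .deg) (σ.reg .u) 0)
        (σ.arr .sum (σ.reg .u)) (σ.arr .deg (σ.arr .sum (σ.reg .u)) - 1) →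
      (∃ s < n, s + σ.reg .u ≡ σ.arr .sum (σ.arr .sum (σ.reg .u)) [MOD n] ∧
        σ'.arr .sum = Function.update (σ.arr .sum) (σ.arr .sum (σ.reg .u)) s) →
      σ'.reg .ans = (if σ.arr .deg (σ.arr .sum (σ.reg .u)) = 1 then 0 else σ.reg .ans) →
      PathInv n m Q v (k - 1) σ' := by
    rintro σ' hstd hi hu hc hdeg ⟨s, hs, hsmod, hsum⟩ hans'
    refine ⟨⟨hstd, hi.trans h.i, h.le, by rw [hdeg]; omega, ?_⟩, by rw [hu]; exact hwn, ?_, ?_⟩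
    · obtain ⟨N', hN', hsol⟩ := hN.exists_peel hun hb hs hsmod
      refine ⟨N', by rwa [hdeg, hsum], ?_⟩
      rw [hans', hdeg]
      split_ifs at hsol ⊢ with h1
      · right
        rcases hans with ⟨-, hQ⟩ | ⟨-, hQ⟩
        · exact ⟨rfl, fun h => hsol (hQ.1 h)⟩
        · exact ⟨rfl, hQ⟩
      · rwa [← hsol]
    · rw [hc, hdeg, hu, Function.update_self]
    · intro a ha hau
      rw [hu] at hau
      rw [hdeg, Function.update_of_ne hau, Function.update_apply]
      split_ifs with h1
      · exact zero_ne_one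
      · exact h.ne_one a ha h1
  simp only [peelCmd, Cmd.wp, AState.reg_setReg, AState.arr_setReg, AState.reg_setArr,
    AState.arr_setArr, Cond.Holds, reduceCtorEq, if_true, if_false, h.std.one, h.std.zero,
    h.std.n, Function.update_of_ne hwu, Function.update_self]
  have hmod1 : σ.arr .sum (σ.arr .sum (σ.reg .u)) + n - σ.reg .u + σ.reg .u ≡
      σ.arr .sum (σ.arr .sum (σ.reg .u)) [MOD n] := by
    rw [Nat.sub_add_cancel (by omega)]
    exact Nat.add_modEq_right
  have hmod2 : ¬ σ.arr .sum (σ.arr .sum (σ.reg .u)) + n - σ.reg .u < n →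
      σ.arr .sum (σ.arr .sum (σ.reg .u)) + n - σ.reg .u - n + σ.reg .u ≡
      σ.arr .sum (σ.arr .sum (σ.reg .u)) [MOD n] := by
    intro hlt
    rw [show σ.arr .sum (σ.arr .sum (σ.reg .u)) + n - σ.reg .u - n + σ.reg .u =
      σ.arr .sum (σ.arr .sum (σ.reg .u)) by omega]
  repeat' first | apply And.intro | intro _
  all_goals try omega
  all_goals
    apply hfin
    · constructor <;> simp [h.std.zero, h.std.one, h.std.two, h.std.n, h.std.fin]
    iterate 4 simp
    · refine ⟨_, ?_, ?_, by simp; rfl⟩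
      · omega
      · first | exact hmod1 | exact hmod2 (by assumption)
    · simp [*]

/-- The path may run through vertices on either side of `v`. It ends when the current vertex is not
a leaf, and then no leaf is left up to `v`. -/
theorem runs_pathProg (hW : 100 * (n + m + 1) ≤ W) {v k : ℕ} {σ : AState}
    (h : PeelInv n m Q v k σ) (hne : ∀ u < v, σ.arr .deg u ≠ 1) (hv : v < n) :
    Runs W (4 * m + 2) pathProg σ fun t σ' => ∃ k', t + 101 * k' ≤ 101 * k + 102 ∧
      PeelInv n m Q (v + 1) k' σ' ∧ ∀ u < v + 1, σ'.arr .deg u ≠ 1 := by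
  refine (startCmd.runs (Q := PathInv n m Q v k) ?_).seq fun t₁ σ₁ ⟨ht₁, h₁⟩ => ?_
  · simp only [startCmd, Cmd.wp, AState.reg_setReg, AState.arr_setReg, if_true,
      h.i]
    refine ⟨by omega, ⟨?_, h.i, h.le, h.num_le, h.graph⟩, by simpa using hv, by simp, ?_⟩
    · constructor <;> simp [h.std.zero, h.std.one, h.std.two, h.std.n, h.std.fin]
    · intro u hu huv
      refine hne u ?_
      have : u ≠ v := by simpa using huv
      omega
  refine (Runs.loop (fun K σ => ∃ k, PathInv n m Q v k σ ∧ K = 101 * k) ?_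
    ⟨_, h₁, rfl⟩).seq fun t₂ σ₂ h₂ => ?_
  · rintro _ σ ⟨k, hi, rfl⟩ hb
    exact (runs_peelCmd hW hi hb).mono fun t σ' ⟨ht, hk, h'⟩ =>
      ⟨_, ⟨_, h', rfl⟩, by omega⟩
  obtain ⟨_, ⟨k₂, h₂, rfl⟩, hb₂, ht₂⟩ := h₂
  refine ((Cmd.add .i .i .one).runs (Q := fun σ' => PeelInv n m Q (v + 1) k₂ σ' ∧
    ∀ u < v + 1, σ'.arr .deg u ≠ 1) ?_).mono fun t₃ σ₃ ⟨ht₃, h₃⟩ => ⟨k₂, ?_, h₃⟩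
  · simp only [Cmd.wp, h₂.i, h₂.std.one]
    refine ⟨by omega, ⟨?_, by simp, hv, h₂.num_le, h₂.graph⟩, fun u hu => ?_⟩
    · constructor <;> simp [h₂.std.zero, h₂.std.one, h₂.std.two, h₂.std.n, h₂.std.fin]
    · by_cases huu : u = σ₂.reg .u
      · have hc : ¬ σ₂.reg .c = σ₂.reg .one := hb₂
        rw [h₂.c, h₂.std.one, ← huu] at hc
        exact hc
      · exact h₂.ne_one u hu huu
  · have h1 : startCmd.cost = 6 := rfl
    have h2 : (Cmd.add .i .i .one).cost = 1 := rfl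
    omega

/-- Remove leaves as long as possible. -/
def peelProg : Prog := .loop (Cond.lt .i .n).test pathProg

theorem runs_peelProg (hW : 100 * (n + m + 1) ≤ W) {k : ℕ} {σ : AState}
    (h : PeelInv n m Q 0 k σ) :
    Runs W (4 * m + 2) peelProg σ fun t σ' => t ≤ 103 * n + 101 * k + 1 ∧
      ((Q ∧ σ'.reg .ans = 1) ∨ (¬ Q ∧ σ'.reg .ans = 0)) := by
  refine (Runs.loop (fun K σ => ∃ v k, PeelInv n m Q v k σ ∧ (∀ u < v, σ.arr .deg u ≠ 1) ∧
    K = 103 * (n - v) + 101 * k) ?_ ⟨0, k, h, by simp, rfl⟩).mono ?_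
  · rintro _ σ ⟨v, k, hi, hne, rfl⟩ hb
    have hv : v < n := by
      have : σ.reg .i < σ.reg .n := hb
      rwa [hi.i, hi.std.n] at this
    exact (runs_pathProg hW hi hne hv).mono fun t σ' ⟨k', ht, h', hne'⟩ =>
      ⟨_, ⟨v + 1, k', h', hne', rfl⟩, by omega⟩
  · rintro t σ' ⟨_, ⟨v, k', hi, hne, rfl⟩, hb, ht⟩
    have hv : ¬ v < n := by
      have : ¬ σ'.reg .i < σ'.reg .n := hb
      rwa [hi.i, hi.std.n] at this
    obtain rfl : v = n := le_antisymm hi.le (not_lt.1 hv)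
    refine ⟨by omega, ?_⟩
    obtain ⟨N, hN, ⟨ha, hQ⟩ | ⟨ha, hQ⟩⟩ := hi.graph
    · exact .inl ⟨hQ.2 (hN.solvable hne), ha⟩
    · exact .inr ⟨hQ, ha⟩

end RAM

/-! ## The graph of the instance -/

theorem List.getD_flatMap_of_length_eq {α β : Type*} {k : ℕ} (l : List α) (F : α → List β)
    (hF : ∀ a, (F a).length = k) (d : β) {i r : ℕ} (hi : i < l.length) (hr : r < k) :
    (l.flatMap F).getD (k * i + r) d = (F l[i]).getD r d := by
  induction l generalizing i with
  | nil => simp at hi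
  | cons a l ih =>
    rw [List.flatMap_cons]
    obtain _ | i := i
    · rw [List.getD_append _ _ _ _ (by rw [hF]; omega)]
      simp
    · rw [List.getD_append_right _ _ _ _ (by rw [hF, mul_add]; omega), hF,
        show k * (i + 1) + r - k = k * i + r by rw [mul_add]; omega]
      exact ih (by simpa using hi)

namespace EFInstance

variable {n m : ℕ} {I : EFInstance n m} {x y : Fin m → Fin n}

theorem length_encode : (I.encode x y).length = 4 * m + 2 := by
  simp [encode, List.length_flatMap, mul_comm]

theorem encode_getD (e : Fin m) {r : ℕ} (hr : r < 4) :
    (I.encode x y).getD (4 * e + r + 2) 0 =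
      [(x e : ℕ), (y e : ℕ), I.val (x e) e, I.val (y e) e].getD r 0 := by
  have := List.getD_flatMap_of_length_eq (k := 4) (List.finRange m)
    (fun e => [(x e : ℕ), (y e : ℕ), I.val (x e) e, I.val (y e) e]) (fun _ => rfl) 0
    (i := e) (r := r) (by simp) hr
  rw [encode, List.getD_cons_succ, List.getD_cons_succ, this]
  simp

variable {f : ℕ → ℕ}

/-- The input area `f` contains the instance. -/
structure IsInputArea (I : EFInstance n m) (x y : Fin m → Fin n) (f : ℕ → ℕ) : Prop where
  fst : ∀ e : Fin m, f (4 * e + 2) = x e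
  snd : ∀ e : Fin m, f (4 * e + 3) = y e
  val_fst : ∀ e : Fin m, f (4 * e + 4) = I.val (x e) e
  val_snd : ∀ e : Fin m, f (4 * e + 5) = I.val (y e) e

theorem isInputArea_encode : I.IsInputArea x y fun a => (I.encode x y).getD a 0 :=
  ⟨fun e => encode_getD e (r := 0) (by omega), fun e => encode_getD e (r := 1) (by omega),
    fun e => encode_getD e (r := 2) (by omega), fun e => encode_getD e (r := 3) (by omega)⟩

namespace IsInputArea

theorem isInput (h : I.IsInputArea x y f) (hI : I.IsBinary) : RAM.IsInput n m f where
  fst_lt e he := by rw [h.fst ⟨e, he⟩]; exact (x ⟨e, he⟩).2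
  snd_lt e he := by rw [h.snd ⟨e, he⟩]; exact (y ⟨e, he⟩).2
  val_le e he := by
    rw [h.val_fst ⟨e, he⟩]
    rcases hI (x ⟨e, he⟩) ⟨e, he⟩ with h | h <;> omega
  val_le' e he := by
    rw [h.val_snd ⟨e, he⟩]
    rcases hI (y ⟨e, he⟩) ⟨e, he⟩ with h | h <;> omega

theorem _root_.RAM.count_targets (f : ℕ → ℕ) (e v j : ℕ) :
    (RAM.targets f e v).count j = ∑ e' ∈ Finset.range e,
      if f (4 * e' + 4) + f (4 * e' + 5) = 2 then
        ((if f (4 * e' + 3) = v ∧ f (4 * e' + 2) = j then 1 else 0) +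
          if f (4 * e' + 2) = v ∧ f (4 * e' + 3) = j then 1 else 0) else 0 := by
  induction e with
  | zero => simp [RAM.targets]
  | succ e ih =>
    rw [Finset.sum_range_succ, ← ih, RAM.targets, List.count_append, List.count_append]
    by_cases h2 : f (4 * e + 4) + f (4 * e + 5) = 2
    · by_cases h3 : f (4 * e + 3) = v <;> by_cases h4 : f (4 * e + 2) = v <;>
        simp [h2, h3, h4, List.count_singleton] <;> omega
    · simp [h2]

theorem count_targets (h : I.IsInputArea x y f) (hxy : I.IsEndpointList x y)
    (hI : I.IsBinary) (i j : Fin n) : (RAM.targets f m i).count (j : ℕ) = I.mult i j := by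
  rw [RAM.count_targets, mult, Finset.card_filter, ← Fin.sum_univ_eq_sum_range (fun e' =>
    if f (4 * e' + 4) + f (4 * e' + 5) = 2 then
        ((if f (4 * e' + 3) = i ∧ f (4 * e' + 2) = j then 1 else 0) +
          if f (4 * e' + 2) = i ∧ f (4 * e' + 3) = j then 1 else 0) else 0)]
  refine Finset.sum_congr rfl fun e _ => ?_
  rw [h.fst, h.snd, h.val_fst, h.val_snd]
  have hne := hxy.ne e
  have hmut := hxy.mutual_iff (e := e) (i := i) (j := j)
  have h2 : I.val (x e) e + I.val (y e) e = 2 ↔ I.val (x e) e = 1 ∧ I.val (y e) e = 1 := by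
    rcases hI (x e) e with h | h <;> rcases hI (y e) e with h' | h' <;> omega
  simp only [hmut, h2, ← Fin.ext_iff]
  by_cases h11 : I.val (x e) e = 1 ∧ I.val (y e) e = 1
  · by_cases h3 : x e = i ∧ y e = j
    · have h4 : ¬ (y e = i ∧ x e = j) := fun h4 => hne (h3.1.trans h4.1.symm)
      rw [if_pos h11, if_neg h4, if_pos h3, if_pos ⟨h11, .inl h3⟩]
    · by_cases h4 : y e = i ∧ x e = j
      · rw [if_pos h11, if_pos h4, if_neg h3, if_pos ⟨h11, .inr h4.symm⟩]
      · have h5 : ¬ (x e = j ∧ y e = i) := fun h => h4 h.symm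
        rw [if_pos h11, if_neg h4, if_neg h3, if_neg (by tauto)]
  · simp [h11]

/-- For values in `{0, 1}`, `RAM.gain` is `2` for an exclusive good, `1` for a mutual good and `0`
otherwise, so the left side of the need inequality is computed without halving. -/
theorem slack_eq (h : I.IsInputArea x y f) (hxy : I.IsEndpointList x y)
    (hI : I.IsBinary) (i : Fin n) :
    RAM.slack f m i = 2 * I.excl i + ∑ j, I.mult i j := by
  have h1 : ∑ e, I.val i e = I.excl i + ∑ j, I.mult i j := hxy.value_eq hI i Finset.univ
  have h2 : I.excl i = ∑ e, if I.Excl i e then 1 else 0 := Finset.card_filter ..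
  have h3 : RAM.slack f m i = ∑ e, (I.val i e + if I.Excl i e then 1 else 0) := by
    rw [RAM.slack, ← Fin.sum_univ_eq_sum_range (fun e' =>
      ((if f (4 * e' + 2) = i then RAM.gain (f (4 * e' + 4)) (f (4 * e' + 5)) else 0) +
      if f (4 * e' + 3) = i then RAM.gain (f (4 * e' + 5)) (f (4 * e' + 4)) else 0))]
    refine Finset.sum_congr rfl fun e _ => ?_
    have hne := hxy.ne e
    rw [h.fst, h.snd, h.val_fst, h.val_snd]
    simp only [← Fin.ext_iff, hxy.excl_iff hI, RAM.gain]
    by_cases hx : x e = i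
    · subst hx
      rcases hI (x e) e with ha | ha <;> rcases hI (y e) e with hb | hb <;>
        simp [hne.symm, ha, hb]
    by_cases hy : y e = i
    · subst hy
      rcases hI (x e) e with ha | ha <;> rcases hI (y e) e with hb | hb <;>
        simp [hne, ha, hb]
    have h0 : I.val i e = 0 := (hI i e).resolve_right fun h1 => by
      rcases hxy.of_val h1 with rfl | rfl <;> contradiction
    simp [hx, hy, h0]
  rw [h3, Finset.sum_add_distrib, h1, ← h2]
  omega

theorem oddSet_targets (h : I.IsInputArea x y f) (hxy : I.IsEndpointList x y)
    (hI : I.IsBinary) (i : Fin n) :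
    (RAM.targets f m i).oddSet = (I.oddNbrs i).map Fin.valEmbedding := by
  ext j
  simp only [List.mem_oddSet, Finset.mem_map, oddNbrs, Finset.mem_filter_univ,
    Fin.valEmbedding_apply]
  constructor
  · intro hj
    have hjn : j < n := (h.isInput hI).targets_lt le_rfl i j
      (List.count_pos_iff.1 (by omega))
    refine ⟨⟨j, hjn⟩, ?_, rfl⟩
    rw [← h.count_targets hxy hI, Nat.odd_iff]
    exact hj
  · rintro ⟨j, hj, rfl⟩
    rwa [h.count_targets hxy hI, ← Nat.odd_iff]

theorem needyDeg_ne_zero_iff (h : I.IsInputArea x y f) (hxy : I.IsEndpointList x y)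
    (hI : I.IsBinary) (i : Fin n) : RAM.needyDeg f m i ≠ 0 ↔ I.Needy i := by
  classical
  have hcard : (RAM.targets f m i).oddSet.card = (I.oddNbrs i).card := by
    rw [h.oddSet_targets hxy hI, Finset.card_map]
  rw [RAM.needyDeg, ite_ne_right_iff, RAM.NeedyAt, Needy, hcard, h.slack_eq hxy hI,
    Finset.card_ne_zero, and_comm, and_congr_right_iff]
  intro _
  constructor
  · rintro ⟨j, hj⟩
    by_cases hjn : j < n
    · exact ⟨⟨j, hjn⟩, by rw [← h.count_targets hxy hI]; exact hj⟩
    -- A number that is not a vertex never occurs as a target; the index `i` itself has the same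
    -- multiplicity `0`.
    · refine ⟨i, ?_⟩
      rw [List.count_eq_zero.2 fun hm =>
        hjn ((h.isInput hI).targets_lt le_rfl i j hm)] at hj
      rw [mult_self]
      exact hj
  · rintro ⟨j, hj⟩
    exact ⟨j, by rw [h.count_targets hxy hI]; exact hj⟩

theorem hasEFOrientation_iff (h : I.IsInputArea x y f) (hxy : I.IsEndpointList x y)
    (hI : I.IsBinary) : I.HasEFOrientation ↔
      Solvable (fun v => if v < n then (RAM.targets f m v).oddSet else ∅)
        fun v => v < n ∧ RAM.needyDeg f m v ≠ 0 := by
  rw [hxy.hasEFOrientation_iff_solvable hI]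
  refine solvable_fin_iff (fun i => ?_) (fun i => ?_) fun u hu => hu.1
  · rw [if_pos i.2, h.oddSet_targets hxy hI]
  · rw [h.needyDeg_ne_zero_iff hxy hI, and_iff_right i.2]

theorem isPeelState (h : I.IsInputArea x y f) (hxy : I.IsEndpointList x y)
    (hI : I.IsBinary) {deg sum : ℕ → ℕ}
    (hdeg : ∀ v < n, deg v = RAM.needyDeg f m v) (hlt : ∀ v < n, sum v < n)
    (hsum : ∀ v < n, sum v ≡ ∑ j ∈ (RAM.targets f m v).oddSet, j [MOD n]) :
    IsPeelState n deg sum fun v => if v < n then (RAM.targets f m v).oddSet else ∅ := by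
  have hodd : ∀ u v, v ∈ (if u < n then (RAM.targets f m u).oddSet else ∅) ↔
      ∃ (hu : u < n) (hv : v < n), Odd (I.mult ⟨u, hu⟩ ⟨v, hv⟩) := by
    intro u v
    by_cases hu : u < n
    · have := h.oddSet_targets hxy hI ⟨u, hu⟩
      simp only at this
      rw [if_pos hu, this]
      simp only [Finset.mem_map, oddNbrs, Finset.mem_filter_univ, Fin.valEmbedding_apply]
      constructor
      · rintro ⟨j, hj, rfl⟩
        exact ⟨hu, j.2, hj⟩
      · rintro ⟨_, hv, hj⟩
        exact ⟨⟨v, hv⟩, hj, rfl⟩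
    · simp [hu]
  refine ⟨?_, ?_, ?_, hlt, ?_, ?_⟩
  · intro u v
    rw [hodd, hodd]
    rintro ⟨hu, hv, ho⟩
    exact ⟨hv, hu, mult_comm (I := I) _ _ ▸ ho⟩
  · intro u
    rw [hodd]
    rintro ⟨hu, _, ho⟩
    rw [mult_self] at ho
    exact absurd ho (by decide)
  · intro v hv hd
    rw [if_pos hv, hdeg v hv]
    rw [hdeg v hv] at hd
    unfold RAM.needyDeg at hd ⊢
    split_ifs at hd ⊢ with h'
    · rfl
    · exact absurd rfl hd
  · intro v hv _
    rw [if_pos hv]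
    exact hsum v hv
  · intro v j
    rw [hodd]
    rintro ⟨_, hj, _⟩
    exact hj

end IsInputArea

end EFInstance

/-! ## The whole program -/

namespace RAM

set_option linter.constructorNameAsVariable false

/-- Set up the registers. -/
def initProg : Prog :=
  .seq (.instr (.load 4 0)) (.seq (.instr (.const 2 1)) (.seq (.instr (.load 5 2))
  (.seq (.instr (.add 5 5 5)) (.seq (.instr (.add 5 5 5)) (.seq (.instr (.const 3 2))
  (.seq (.instr (.add 5 5 3)) (.seq (.instr (.move 7 3)) (.seq (.instr (.move 40 5))
  (.seq (.instr (.add 41 40 2)) (.seq (.instr (.add 42 41 2)) (.seq (.instr (.add 43 42 2))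
  (.seq (.instr (.add 44 43 2)) (.instr (.add 45 44 2))))))))))))))

theorem exec_initProg {n m W : ℕ} (hW : 100 * (n + m + 1) ≤ W) {l : List ℕ}
    (hl : l.length = 4 * m + 2) (h0 : l.getD 0 0 = n) (h1 : l.getD 1 0 = m) :
    ∃ s σ, Exec W initProg (initState l) 14 s ∧ Rep (4 * m + 2) σ s ∧
      ReadInv n m (fun a => l.getD a 0) 0 σ := by
  have hreg : ∀ (s : State) (d v r : ℕ), (s.setReg d v).reg r = if r = d then v else s.reg r :=
    fun s d v r => Function.update_apply ..
  have hmem : ∀ (s : State) (d v : ℕ), (s.setReg d v).mem = s.mem := fun _ _ _ => rfl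
  have hr0 : ∀ r, (initState l).reg r = 0 := fun _ => rfl
  have hm0 : ∀ a, (initState l).mem a = l.getD a 0 := fun _ => rfl
  have eload : ∀ (s : State) (d a v : ℕ), s.mem (s.reg a) = v →
      Exec W (.instr (.load d a)) s 1 (s.setReg d v) := by
    rintro s d a _ rfl; exact .instr rfl
  have emove : ∀ (s : State) (d a v : ℕ), s.reg a = v →
      Exec W (.instr (.move d a)) s 1 (s.setReg d v) := by
    rintro s d a _ rfl; exact .instr rfl
  have econst : ∀ (s : State) (d k : ℕ), k ≤ W →
      Exec W (.instr (.const d k)) s 1 (s.setReg d k) := fun s d k h => .instr (if_pos h)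
  have eadd : ∀ (s : State) (d a b v : ℕ), s.reg a + s.reg b = v → v ≤ W →
      Exec W (.instr (.add d a b)) s 1 (s.setReg d v) := by
    rintro s d a b _ rfl h; exact .instr (if_pos h)
  have hexec := Exec.seq (eload (initState l) 4 0 n (by simp only [hm0, hr0, h0]))
    (.seq (econst _ 2 1 (by omega))
    (.seq (eload _ 5 2 m (by simp [hreg, hmem, hm0]; simpa using h1))
    (.seq (eadd _ 5 5 5 (2 * m) (by simp [hreg]; omega) (by omega))
    (.seq (eadd _ 5 5 5 (4 * m) (by simp [hreg]; omega) (by omega))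
    (.seq (econst _ 3 2 (by omega))
    (.seq (eadd _ 5 5 3 (4 * m + 2) (by simp [hreg]) (by omega))
    (.seq (emove _ 7 3 2 (by simp [hreg]))
    (.seq (emove _ 40 5 (4 * m + 2) (by simp [hreg]))
    (.seq (eadd _ 41 40 2 (4 * m + 2 + 1) (by simp [hreg]) (by omega))
    (.seq (eadd _ 42 41 2 (4 * m + 2 + 2) (by simp [hreg]) (by omega))
    (.seq (eadd _ 43 42 2 (4 * m + 2 + 3) (by simp [hreg]) (by omega))
    (.seq (eadd _ 44 43 2 (4 * m + 2 + 4) (by simp [hreg]) (by omega))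
    (eadd _ 45 44 2 (4 * m + 2 + 5) (by simp [hreg]) (by omega))))))))))))))
  refine ⟨_, ⟨fun r => _, fun a => l.getD a 0, 0⟩, hexec, ⟨fun r => rfl, ?_, fun a _ => rfl, ?_⟩,
    ⟨?_, Nat.zero_le _, ?_, fun _ _ => rfl, rfl, fun v => ?_, rfl, rfl, rfl⟩⟩
  · intro k
    cases k <;> simp [hreg, Arr.idx]
  · intro k a
    simp only [hmem, hm0]
    -- Array addresses lie beyond the input, where memory is initially `0`; so all arrays start out
    -- cleared.
    rw [List.getD_eq_default _ _ (by omega)]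
    rfl
  · constructor <;> simp [hreg, Reg.idx, hr0]
  · simp [hreg, Reg.idx]
  · rfl

/-- The decision procedure. -/
def efProg : Prog :=
  .seq initProg (.seq readProg (.seq (Cmd.const .i 0).prog (.seq evalProg
    (.seq (Cmd.const .ans 1 ;; Cmd.const .i 0).prog peelProg))))

theorem runs_efProg {n m W : ℕ} (hW : 100 * (n + m + 1) ≤ W) {I : EFInstance n m}
    (hI : I.IsBinary) {x y : Fin m → Fin n} (hxy : I.IsEndpointList x y) {f : ℕ → ℕ}
    (hf : I.IsInputArea x y f) {σ : AState} (h : ReadInv n m f 0 σ) :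
    Runs W (4 * m + 2) (.seq readProg (.seq (Cmd.const .i 0).prog (.seq evalProg
      (.seq (Cmd.const .ans 1 ;; Cmd.const .i 0).prog peelProg)))) σ fun t σ' =>
        t ≤ 408 * n + 505 * m + 6 ∧ ((I.HasEFOrientation ∧ σ'.reg .ans = 1) ∨
          (¬ I.HasEFOrientation ∧ σ'.reg .ans = 0)) := by
  have hin := hf.isInput hI
  refine (runs_readProg hW hin h).seq fun t₁ σ₁ ⟨ht₁, h₁⟩ => ?_
  refine ((Cmd.const .i 0).runs (Q := ListInv n m f σ₁.inp 0) ?_).seq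
    fun t₂ σ₂ ⟨ht₂, h₂⟩ => ?_
  · refine ⟨Nat.zero_le _, ⟨?_, by simp, rfl, h₁.slack, h₁.chain, by simp [h₁.deg], by simp,
      by simp⟩, Nat.zero_le _, h₁.cnt, h₁.par⟩
    constructor <;> simp [h₁.std.zero, h₁.std.one, h₁.std.two, h₁.std.n, h₁.std.fin]
  refine (runs_evalProg hW hin h₂).seq fun t₃ σ₃ ⟨ht₃, h₃⟩ => ?_
  refine ((Cmd.const .ans 1 ;; Cmd.const .i 0).runs
    (Q := PeelInv n m I.HasEFOrientation 0 n) ?_).seq fun t₄ σ₄ ⟨ht₄, h₄⟩ => ?_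
  · have hdeg : ∀ v < n, σ₃.arr .deg v = needyDeg f m v := fun v hv => by
      rw [h₃.deg, if_pos hv]
    refine ⟨by omega, Nat.zero_le _, ?_, by simp, Nat.zero_le _, numNonzero_le _ _,
      _, hf.isPeelState hxy hI hdeg h₃.sum_lt h₃.sum, .inl ⟨by simp, ?_⟩⟩
    · constructor <;> simp [h₃.std.zero, h₃.std.one, h₃.std.two, h₃.std.n, h₃.std.fin]
    · rw [hf.hasEFOrientation_iff hxy hI]
      refine Solvable.congr (fun v => and_congr_right fun hv => ?_) fun _ _ => rfl
      rw [← hdeg v hv]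
      rfl
  refine (runs_peelProg hW h₄).mono fun t₅ σ₅ ⟨ht₅, h₅⟩ => ⟨?_, h₅⟩
  have hc₂ : (Cmd.const .i 0).cost = 1 := rfl
  have hc₄ : (Cmd.const .ans 1 ;; Cmd.const .i 0).cost = 2 := rfl
  omega

end RAM

/-- EF Orientation with binary valuations on multigraphs is decided in time `O(n + m)` by a
RAM program whose words never exceed `O(n + m)`. -/
theorem mainTheorem9 :
    ∃ (p : RAM.Prog) (c : ℕ), ∀ (n m : ℕ) (I : EFInstance n m), I.IsBinary →
      ∀ x y : Fin m → Fin n, I.IsEndpointList x y →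
        RAM.DecidesWithin (c * (n + m + 1)) p (I.encode x y) (c * (n + m + 1))
          I.HasEFOrientation := by
  -- A generous constant: the time is at most `408 * n + 505 * m + 20`, and capacity `100 * (n + m +
  -- 1)` already suffices.
  refine ⟨RAM.efProg, 1000, fun n m I hI x y hxy => ?_⟩
  have hW : 100 * (n + m + 1) ≤ 1000 * (n + m + 1) := by omega
  obtain ⟨s, σ, he, hr, hinv⟩ := RAM.exec_initProg (l := I.encode x y) hW
    EFInstance.length_encode rfl rfl
  obtain ⟨t, s', σ', he', hr', ht, h⟩ :=
    RAM.runs_efProg hW hI hxy EFInstance.isInputArea_encode hinv s hr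
  refine ⟨14 + t, s', .seq he he', by omega, ?_⟩
  rw [← hr'.reg .ans] at h
  exact h
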